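/- Let $X$ be a countably infinite set and let $b: X\times X\to\{0,1\}$ be symmetric with $b(x,x)=0$ and $\sum_y b(x,y)<\infty$ for all $x$; write $x\sim y$ if $b(x,y)=1$. This is a graph $G$ with standard edge weights, and we equip it with the counting measure $m\equiv1$. Assume that $G$ is connected, let $d$ be the combinatorial graph distance (the least number of edges in a path), fix a vertex $x_0$ and let $V(r)=\#\{x : d(x,x_0)\le r\}$, $r \in \mathbb{N}_0$. For a finite set $K\subset X$ let $L_K$ be the operator on functions on $K$ given by $L_Kf(x)=\sum_{y\in X} b(x,y)(f(x)-f(y))$, $x \in K$, where $f$ is extended by $0$ outside $K$; let $p^K_t(x,y)=(e^{-tL_K}1_y)(x)$ for $x,y\in K$, let $p_t(x,y)=\lim_{K\uparrow X}p_t^K(x,y)$ be the heat kernel, and call $G$ stochastically complete if $\sum_{y\in X}p_t(x,y)=1$ for all $x\in X$ and $t\ge0$. (1) If there is a constant $C>0$ such that $V(r)\le C r^3$ for all large $r$, then $G$ is stochastically complete. (2) The exponent $3$ is sharp. Call $G$ an anti-tree with sphere growth $(a_r)_{r\ge0}$, where the $a_r\geq 1$ are integers and $a_0=1$, if $X$ is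 a disjoint union $\bigcup_{r\ge0}A_r$ with $\#A_r=a_r$ and $x\sim y$ holds exactly when $x$ and $y$ lie in successive sets $A_r$, $A_{r+1}$ (in either order). Let $\varepsilon>0$. Then every anti-tree whose sphere growth $a_r$ is of order $r^{2+\varepsilon}$ (that is, $c\,r^{2+\varepsilon}\le a_r\le C\,r^{2+\varepsilon}$ for some $c,C>0$ and all large $r$) is connected, has volume $V(r)$ of order $r^{3+\varepsilon}$ around every vertex $x_0$, and is not stochastically complete; and such anti-trees exist. -/

import Mathlib

open Filter
open scoped ENNReal

/-- A weighted graph `(X, b, m)`: `m` is a strictly positive vertex measure and `b` is a nonnegative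
symmetric edge weight without loops whose sum at every vertex is finite. -/
structure WeightedGraph (X : Type*) where
  /-- the vertex measure -/
  m : X → ℝ
  /-- the edge weight -/
  b : X → X → ℝ
  m_pos : ∀ x, 0 < m x
  b_nonneg : ∀ x y, 0 ≤ b x y
  b_self : ∀ x, b x x = 0
  b_symm : ∀ x y, b x y = b y x
  b_summable : ∀ x, Summable (b x)

namespace WeightedGraph

variable {X : Type*} (G : WeightedGraph X)

/-- Standard edge weights: `b` takes only the values `0` and `1`. -/
def HasStandardWeights : Prop := ∀ x y, G.b x y = 0 ∨ G.b x y = 1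

/-- The vertex measure is the counting measure. -/
def HasCountingMeasure : Prop := ∀ x, G.m x = 1

/-- The extension of the vertex measure to all sets of vertices, by additivity. -/
noncomputable def measure (A : Set X) : ℝ≥0∞ := ∑' x : A, ENNReal.ofReal (G.m x)

/-- The underlying combinatorial graph: `x ∼ y` if and only if `b x y > 0`. -/
def toSimpleGraph : SimpleGraph X where
  Adj x y := 0 < G.b x y
  symm := ⟨fun x y h => by rw [G.b_symm y x]; exact h⟩
  loopless := ⟨fun x h => by rw [G.b_self x] at h; exact lt_irrefl _ h⟩

/-- The graph is connected: any two vertices are joined by a path of neighbors. -/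
def Connected : Prop := G.toSimpleGraph.Connected

/-- The ball `B_r(x₀)` of the combinatorial graph distance (the least number of edges in a path). -/
def ball (x₀ : X) (r : ℕ) : Set X := {x | G.toSimpleGraph.edist x x₀ ≤ r}

/-- The volume `V(r) = m(B_r(x₀))`. -/
noncomputable def vol (x₀ : X) (r : ℕ) : ℝ≥0∞ := G.measure (G.ball x₀ r)

/-- The formal Laplacian `𝓛 f (x) = (1 / m x) ∑_y b x y (f x - f y)`. -/
noncomputable def laplacian (f : X → ℝ) (x : X) : ℝ :=
  1 / G.m x * ∑' y, G.b x y * (f x - f y)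

/-- The matrix, in the basis of the functions `1_y`, `y ∈ K`, of the restriction `L_K` of the formal
Laplacian to a finite set `K`: a function on `K` is extended by zero to `X`, the formal Laplacian is
applied, and the result is restricted to `K`. -/
noncomputable def restrictedLaplacian (K : Finset X) : Matrix K K ℝ :=
  Matrix.of fun x y => G.laplacian (Set.indicator {(y : X)} 1) x

open Classical in
/-- The restricted heat kernel `p_t^K(x, y) = (e^{-t L_K} (1_y / m y)) (x)` for `x, y ∈ K`, extended by
zero to all vertices. -/
noncomputable def restrictedHeatKernel (K : Finset X) (t : ℝ) (x y : X) : ℝ :=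
  if h : x ∈ K ∧ y ∈ K then
    NormedSpace.exp ((-t) • G.restrictedLaplacian K) ⟨x, h.1⟩ ⟨y, h.2⟩ / G.m y
  else 0

/-- The heat kernel `p_t(x, y)` for `t ≥ 0`: the limit of the restricted heat kernels as the finite set
`K` increases to `X`. The restricted heat kernels are nonnegative and nondecreasing in `K`, so
that the limit (along any exhaustion) is the supremum. -/
noncomputable def heatKernel (t : ℝ) (x y : X) : ℝ≥0∞ :=
  ⨆ K : Finset X, ENNReal.ofReal (G.restrictedHeatKernel K t x y)

/-- Stochastic completeness: `∑_y p_t(x, y) m y = 1` for all vertices `x` and all `t ≥ 0`. -/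
def StochasticallyComplete : Prop :=
  ∀ (x : X) (t : ℝ), 0 ≤ t → ∑' y, G.heatKernel t x y * ENNReal.ofReal (G.m y) = 1

/-- `G` is an anti-tree with sphere growth `a`: it has standard edge weights and counting measure, and
its vertex set is a disjoint union of sets `A r` with `a r` elements (`a 0 = 1` and `a r ≥ 1`), such that
the edges are exactly the pairs of vertices from successive sets. -/
structure IsAntiTree (a : ℕ → ℕ) : Prop where
  zero : a 0 = 1
  pos : ∀ r, 0 < a r
  standard : G.HasStandardWeights
  counting : G.HasCountingMeasure
  layers : ∃ A : ℕ → Set X,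
    Pairwise (fun r s => Disjoint (A r) (A s)) ∧
    (⋃ r, A r) = Set.univ ∧
    (∀ r, G.measure (A r) = (a r : ℝ≥0∞)) ∧
    ∀ x y, (G.b x y = 1 ↔
      ∃ r, (x ∈ A r ∧ y ∈ A (r + 1)) ∨ (y ∈ A r ∧ x ∈ A (r + 1)))

end WeightedGraph

/-- The sequence `v` is of order `r ^ p`: it lies between two positive multiples of `r ^ p` for all
large `r`. -/
def IsOfOrder (v : ℕ → ℝ≥0∞) (p : ℝ) : Prop :=
  ∃ c C : ℝ, 0 < c ∧ 0 < C ∧ ∀ᶠ r : ℕ in atTop,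
    ENNReal.ofReal (c * (r : ℝ) ^ p) ≤ v r ∧ v r ≤ ENNReal.ofReal (C * (r : ℝ) ^ p)

/-! Both halves follow the mass lost by `e^{-t L_K} 1` as `K` exhausts `X`. The restricted kernels
are nonnegative and increase with `K`, because a matrix with nonnegative off-diagonal entries has a
nonnegative exponential that dominates those of its principal submatrices.

Completeness. The deficit `u = 1 - e^{-t L_K} 1`, set to `1` off `K`, solves the heat equation in
`K` with initial value `0`. Let `ω > 0` be summable, vanish at infinity and satisfy `∑_y b x y (ω x
- ω y)² ≤ A (ω x)² m x`. With `K = {ω > δ}` and the cutoff `(ω - δ)₊`, a Caccioppoli inequality and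
Gronwall bound `∑ u² (ω - δ)₊² m` by a multiple of `δ` at each fixed time, so `u → 0` pointwise as
`δ → 0` (`stochasticallyComplete_of_weight`).

Under cubic growth the weight is `ω = exp (-10 h)` with `h` radial. Spheres have size about `k²`
only on average, so `h` cannot simply grow by `1 / k` at each step. Its increments are `1 / k` minus
a multiple of `D k / k³`, truncated at zero, where `D k` counts two successive spheres. No increment
is left across an oversized pair, which bounds the gradient of `h`; summation by parts shows that
half of the harmonic sum survives. Hence `h ≥ (log r) / 2 - const`, and `ω` decays like `r⁻⁵`, fast
enough to be summable.

Incompleteness. If `v ≥ 0` and `𝓛 v ≥ 1`, then `t e^{-t L_K} 1 ≤ v` for every `K`, so mass is lost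
at `x` by any time `t > v x`. On an anti-tree, let `v` be radial, dropping by `V k / (a k * a (k +
1))` from level `k` to the next, with `V k = a 0 + ... + a k`. Then `𝓛 v = 1`, and for `a k` of
order `k ^ (2 + ε)` the drops are of order `k ^ (-1 - ε)`, hence summable. -/

namespace Matrix

/-! ### Matrix exponentials and entrywise positivity -/

open NormedSpace

variable {m n : Type*} [Fintype m] [DecidableEq m] [Fintype n] [DecidableEq n]

open scoped Norms.Operator in
theorem hasSum_exp_apply (A : Matrix n n ℝ) (x y : n) :
    HasSum (fun k : ℕ => (k.factorial : ℝ)⁻¹ * (A ^ k) x y) (exp A x y) := by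
  have h := exp_series_hasSum_exp' (𝕂 := ℝ) A
  have h1 := (Pi.hasSum.1 ((Pi.hasSum.1 h) x)) y
  exact h1

open scoped Norms.Operator in
theorem hasDerivAt_exp_smul_mulVec (A : Matrix n n ℝ) (v : n → ℝ) (x : n) (t : ℝ) :
    HasDerivAt (fun s : ℝ => (exp (s • A) *ᵥ v) x) ((exp (t • A) *ᵥ (A *ᵥ v)) x) t := by
  have h : HasDerivAt (fun s : ℝ => exp (s • A)) (exp (t • A) * A) t :=
    hasDerivAt_exp_smul_const A t
  have h1 : ∀ x y, HasDerivAt (fun s : ℝ => exp (s • A) x y) ((exp (t • A) * A) x y) t :=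
    fun x y => hasDerivAt_pi.1 (hasDerivAt_pi.1 h x) y
  rw [mulVec_mulVec]
  simp only [mulVec, dotProduct]
  exact HasDerivAt.fun_sum fun y _ => (h1 x y).mul_const (v y)

open scoped Norms.Operator in
theorem exp_smul_mulVec_comm (A : Matrix n n ℝ) (v : n → ℝ) (t : ℝ) :
    exp (t • A) *ᵥ (A *ᵥ v) = A *ᵥ (exp (t • A) *ᵥ v) := by
  rw [mulVec_mulVec, mulVec_mulVec]
  congr 1
  exact (((Commute.refl A).smul_left t).exp_left).eq

/-- Entries of a power are sums over weighted paths; the paths within the smaller index set are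
among all paths, and the others have nonnegative weight. -/
theorem pow_submatrix_apply_le {A : Matrix n n ℝ} (hA : ∀ x y, 0 ≤ A x y) {i : m → n}
    (hi : Function.Injective i) (k : ℕ) (x y : m) :
    (A.submatrix i i ^ k) x y ≤ (A ^ k) (i x) (i y) := by
  induction k generalizing y with
  | zero => simp [one_apply, hi.eq_iff]
  | succ k ih =>
    rw [pow_succ, pow_succ, mul_apply, mul_apply]
    calc ∑ z, (A.submatrix i i ^ k) x z * A.submatrix i i z y
        ≤ ∑ z, (A ^ k) (i x) (i z) * A (i z) (i y) :=
          Finset.sum_le_sum fun z _ => mul_le_mul_of_nonneg_right (ih z) (hA _ _)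
      _ = ∑ w ∈ Finset.univ.map ⟨i, hi⟩, (A ^ k) (i x) w * A w (i y) := by simp
      _ ≤ _ := Finset.sum_le_sum_of_subset_of_nonneg (Finset.subset_univ _)
          fun w _ _ => mul_nonneg (pow_apply_nonneg hA _ _ _) (hA _ _)

open scoped Norms.Operator in
theorem exp_smul_one (c : ℝ) : exp (c • (1 : Matrix n n ℝ)) = Real.exp c • 1 := by
  rw [← Algebra.algebraMap_eq_smul_one, ← Algebra.algebraMap_eq_smul_one, Real.exp_eq_exp_ℝ]
  exact (algebraMap_exp_comm (𝔸 := Matrix n n ℝ) c).symm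

theorem exp_eq_smul_exp_add (A : Matrix n n ℝ) (c : ℝ) :
    exp A = Real.exp (-c) • exp (A + c • 1) := by
  have h1 : A = (-c) • 1 + (A + c • 1) := by simp
  conv_lhs => rw [h1]
  rw [Matrix.exp_add_of_commute _ _ ((Commute.one_left _).smul_left _), exp_smul_one,
    smul_mul_assoc, one_mul]

/-- Shifting by a multiple of the identity only rescales the exponential, so comparisons of
exponentials reduce to termwise comparisons of power series with nonnegative entries. -/
theorem exists_add_smul_one_nonneg {A : Matrix n n ℝ} (hA : ∀ x y, x ≠ y → 0 ≤ A x y) :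
    ∃ c : ℝ, ∀ x y, 0 ≤ (A + c • (1 : Matrix n n ℝ)) x y := by
  refine ⟨∑ z, |A z z|, fun x y => ?_⟩
  rcases eq_or_ne x y with rfl | h
  · have h1 := Finset.single_le_sum (f := fun z => |A z z|) (fun z _ => abs_nonneg _)
      (Finset.mem_univ x)
    have h2 := neg_abs_le (A x x)
    simp only [add_apply, smul_apply, one_apply_eq, smul_eq_mul, mul_one]
    linarith
  · simpa [one_apply_ne h] using hA x y h

/-- The exponential of a matrix with nonnegative off-diagonal entries is nonnegative. -/
theorem exp_apply_nonneg {A : Matrix n n ℝ} (hA : ∀ x y, x ≠ y → 0 ≤ A x y) (x y : n) :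
    0 ≤ exp A x y := by
  obtain ⟨c, hc⟩ := exists_add_smul_one_nonneg hA
  rw [exp_eq_smul_exp_add A c, smul_apply, smul_eq_mul]
  exact mul_nonneg (Real.exp_nonneg _) ((hasSum_exp_apply _ x y).nonneg fun k =>
    mul_nonneg (by positivity) (pow_apply_nonneg hc k x y))

/-- The exponential of a principal submatrix of a matrix with nonnegative off-diagonal entries is
dominated by the exponential of the whole matrix. -/
theorem exp_submatrix_apply_le {A : Matrix n n ℝ} (hA : ∀ x y, x ≠ y → 0 ≤ A x y) {i : m → n}
    (hi : Function.Injective i) (x y : m) :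
    exp (A.submatrix i i) x y ≤ exp A (i x) (i y) := by
  obtain ⟨c, hc⟩ := exists_add_smul_one_nonneg hA
  have h1 : A.submatrix i i + c • 1 = (A + c • 1).submatrix i i := by
    ext x y; simp [one_apply, hi.eq_iff]
  rw [exp_eq_smul_exp_add A c, exp_eq_smul_exp_add _ c, smul_apply, smul_apply, h1]
  refine mul_le_mul_of_nonneg_left ?_ (Real.exp_nonneg _)
  exact hasSum_le (fun k => mul_le_mul_of_nonneg_left (pow_submatrix_apply_le hc hi k x y)
    (by positivity)) (hasSum_exp_apply _ x y) (hasSum_exp_apply _ (i x) (i y))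

theorem exp_mulVec_nonneg {A : Matrix n n ℝ} (hA : ∀ x y, x ≠ y → 0 ≤ A x y) {v : n → ℝ}
    (hv : ∀ x, 0 ≤ v x) (x : n) : 0 ≤ (exp A *ᵥ v) x :=
  Finset.sum_nonneg fun y _ => mul_nonneg (exp_apply_nonneg hA x y) (hv y)

end Matrix

/-! ### Restricted semigroups and the heat kernel -/

namespace WeightedGraph

variable {X : Type*} (G : WeightedGraph X)

open scoped Matrix

open Classical in
theorem restrictedLaplacian_apply (K : Finset X) (x y : K) :
    G.restrictedLaplacian K x y = ((if x = y then ∑' z, G.b x z else 0) - G.b x y) / G.m x := by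
  have h1 : ∀ z, G.b x z * (Set.indicator {(y : X)} (1 : X → ℝ) x
      - Set.indicator {(y : X)} (1 : X → ℝ) z)
      = (if x = y then G.b x z else 0) - (if z = y then G.b x y else 0) := by
    intro z
    by_cases hz : z = y <;> by_cases hx : x = y <;>
      simp [hz, hx]
  have h2 : Summable fun z => if x = y then G.b x z else 0 := by
    split_ifs
    · exact G.b_summable x
    · exact summable_zero
  have h3 : HasSum (fun z => if z = (y : X) then G.b x y else 0) (G.b x y) :=
    hasSum_ite_eq _ _
  rw [restrictedLaplacian, Matrix.of_apply, laplacian, tsum_congr h1, h2.tsum_sub h3.summable,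
    h3.tsum_eq, one_div, inv_mul_eq_div]
  split_ifs <;> simp

theorem restrictedLaplacian_mulVec (K : Finset X) (v : K → ℝ) (x : K) :
    (G.restrictedLaplacian K *ᵥ v) x
      = ((∑' z, G.b x z) * v x - ∑ y : K, G.b x y * v y) / G.m x := by
  classical
  have h : ∀ y : K, G.restrictedLaplacian K x y * v y
      = ((if x = y then (∑' z, G.b x z) * v x else 0) - G.b x y * v y) / G.m x := by
    intro y
    rw [restrictedLaplacian_apply]
    split_ifs with hxy
    · subst hxy; ring
    · ring
  simp only [Matrix.mulVec, dotProduct, h]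
  rw [← Finset.sum_div, Finset.sum_sub_distrib]
  simp

theorem neg_smul_restrictedLaplacian_nonneg (K : Finset X) {t : ℝ} (ht : 0 ≤ t) (x y : K)
    (hxy : x ≠ y) : 0 ≤ ((-t) • G.restrictedLaplacian K) x y := by
  rw [Matrix.smul_apply, restrictedLaplacian_apply, if_neg hxy, zero_sub, smul_eq_mul, neg_div,
    neg_mul_neg]
  exact mul_nonneg ht (div_nonneg (G.b_nonneg _ _) (G.m_pos _).le)

/-- The value is the weight of the edges from `x` out of `K`, divided by `m x`: the rate at which
mass is killed. -/
theorem restrictedLaplacian_mulVec_one_nonneg (K : Finset X) (x : K) :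
    0 ≤ (G.restrictedLaplacian K *ᵥ 1) x := by
  rw [restrictedLaplacian_mulVec]
  refine div_nonneg ?_ (G.m_pos _).le
  simp only [Pi.one_apply, mul_one]
  rw [Finset.sum_coe_sort K (fun y => G.b x y), sub_nonneg]
  exact (G.b_summable x).sum_le_tsum K fun y _ => G.b_nonneg x y

open Classical in
/-- The restricted semigroup `e^{-t L_K}` applied to a function on `K`. -/
noncomputable def restrictedSemigroup (K : Finset X) (t : ℝ) (v : K → ℝ) : K → ℝ :=
  NormedSpace.exp ((-t) • G.restrictedLaplacian K) *ᵥ v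

theorem restrictedSemigroup_zero (K : Finset X) (v : K → ℝ) :
    G.restrictedSemigroup K 0 v = v := by
  classical
  simp [restrictedSemigroup, NormedSpace.exp_zero]

theorem restrictedSemigroup_nonneg (K : Finset X) {t : ℝ} (ht : 0 ≤ t) {v : K → ℝ}
    (hv : ∀ x, 0 ≤ v x) (x : K) : 0 ≤ G.restrictedSemigroup K t v x := by
  classical
  exact Matrix.exp_mulVec_nonneg (G.neg_smul_restrictedLaplacian_nonneg K ht) hv x

theorem restrictedSemigroup_mono (K : Finset X) {t : ℝ} (ht : 0 ≤ t) {v w : K → ℝ}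
    (hvw : ∀ x, v x ≤ w x) (x : K) :
    G.restrictedSemigroup K t v x ≤ G.restrictedSemigroup K t w x := by
  have h := G.restrictedSemigroup_nonneg K ht (v := w - v) (fun y => sub_nonneg.2 (hvw y)) x
  rw [restrictedSemigroup, Matrix.mulVec_sub, Pi.sub_apply, sub_nonneg] at h
  exact h

theorem hasDerivAt_restrictedSemigroup (K : Finset X) (v : K → ℝ) (x : K) (t : ℝ) :
    HasDerivAt (fun s => G.restrictedSemigroup K s v x)
      (-G.restrictedSemigroup K t (G.restrictedLaplacian K *ᵥ v) x) t := by
  classical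
  have h := (Matrix.hasDerivAt_exp_smul_mulVec (G.restrictedLaplacian K) v x (-t)).comp t
    (hasDerivAt_neg t)
  rw [mul_neg_one] at h
  exact h

theorem restrictedSemigroup_laplacian_comm (K : Finset X) (v : K → ℝ) (t : ℝ) :
    G.restrictedSemigroup K t (G.restrictedLaplacian K *ᵥ v)
      = G.restrictedLaplacian K *ᵥ G.restrictedSemigroup K t v := by
  classical
  exact Matrix.exp_smul_mulVec_comm _ _ _

theorem restrictedSemigroup_one_antitoneOn (K : Finset X) (x : K) :
    AntitoneOn (fun t => G.restrictedSemigroup K t 1 x) (Set.Ici 0) := by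
  refine antitoneOn_of_deriv_nonpos (convex_Ici 0)
    (fun t _ => (G.hasDerivAt_restrictedSemigroup K 1 x t).continuousAt.continuousWithinAt)
    (fun t _ =>
      (G.hasDerivAt_restrictedSemigroup K 1 x t).differentiableAt.differentiableWithinAt)
    fun t ht => ?_
  rw [interior_Ici] at ht
  rw [(G.hasDerivAt_restrictedSemigroup K 1 x t).deriv, neg_nonpos]
  exact G.restrictedSemigroup_nonneg K (le_of_lt ht)
    (G.restrictedLaplacian_mulVec_one_nonneg K) x

theorem restrictedSemigroup_one_le_one (K : Finset X) {t : ℝ} (ht : 0 ≤ t) (x : K) :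
    G.restrictedSemigroup K t 1 x ≤ 1 := by
  have h := G.restrictedSemigroup_one_antitoneOn K x (Set.self_mem_Ici) ht ht
  simpa [restrictedSemigroup_zero] using h

theorem restrictedHeatKernel_nonneg (K : Finset X) {t : ℝ} (ht : 0 ≤ t) (x y : X) :
    0 ≤ G.restrictedHeatKernel K t x y := by
  classical
  unfold restrictedHeatKernel
  split_ifs
  · exact div_nonneg (Matrix.exp_apply_nonneg (G.neg_smul_restrictedLaplacian_nonneg K ht) _ _)
      (G.m_pos y).le
  · exact le_rfl

theorem restrictedHeatKernel_mono {t : ℝ} (ht : 0 ≤ t) (x y : X) :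
    Monotone fun K => G.restrictedHeatKernel K t x y := by
  classical
  intro K K' hK
  by_cases h : x ∈ K ∧ y ∈ K
  · have h' : x ∈ K' ∧ y ∈ K' := ⟨hK h.1, hK h.2⟩
    simp only [restrictedHeatKernel, dif_pos h, dif_pos h']
    refine div_le_div_of_nonneg_right ?_ (G.m_pos y).le
    exact Matrix.exp_submatrix_apply_le (G.neg_smul_restrictedLaplacian_nonneg K' ht)
      (i := Set.inclusion hK) (Set.inclusion_injective hK) ⟨x, h.1⟩ ⟨y, h.2⟩
  · simp only [restrictedHeatKernel, dif_neg h]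
    exact G.restrictedHeatKernel_nonneg K' ht x y

theorem sum_restrictedHeatKernel (K : Finset X) (t : ℝ) (x : K) :
    ∑ y ∈ K, G.restrictedHeatKernel K t x y * G.m y = G.restrictedSemigroup K t 1 x := by
  classical
  rw [← Finset.sum_coe_sort, restrictedSemigroup, Matrix.mulVec, dotProduct]
  refine Finset.sum_congr rfl fun y _ => ?_
  rw [restrictedHeatKernel, dif_pos ⟨x.2, y.2⟩, div_mul_cancel₀ _ (G.m_pos y).ne', Pi.one_apply,
    mul_one]

theorem ofReal_restrictedSemigroup_le (K : Finset X) {t : ℝ} (ht : 0 ≤ t) (x : K) :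
    ENNReal.ofReal (G.restrictedSemigroup K t 1 x)
      ≤ ∑' y, G.heatKernel t x y * ENNReal.ofReal (G.m y) := by
  rw [← sum_restrictedHeatKernel, ENNReal.ofReal_sum_of_nonneg fun y _ =>
    mul_nonneg (G.restrictedHeatKernel_nonneg K ht _ _) (G.m_pos y).le]
  refine le_trans (Finset.sum_le_sum fun y _ => ?_) (ENNReal.sum_le_tsum K)
  rw [ENNReal.ofReal_mul (G.restrictedHeatKernel_nonneg K ht _ _)]
  gcongr
  exact le_iSup (fun K : Finset X => ENNReal.ofReal (G.restrictedHeatKernel K t x y)) K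

/-- The total mass of the heat kernel is bounded by any bound for the restricted semigroups. -/
theorem tsum_heatKernel_le {t : ℝ} (ht : 0 ≤ t) (x : X) {c : ℝ}
    (h : ∀ (K : Finset X) (hx : x ∈ K), G.restrictedSemigroup K t 1 ⟨x, hx⟩ ≤ c) :
    ∑' y, G.heatKernel t x y * ENNReal.ofReal (G.m y) ≤ ENNReal.ofReal c := by
  classical
  have hc : 0 ≤ c := (G.restrictedSemigroup_nonneg {x} ht (fun _ => zero_le_one) _).trans
    (h {x} (Finset.mem_singleton_self x))
  rw [ENNReal.tsum_eq_iSup_sum]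
  refine iSup_le fun F => ?_
  simp only [heatKernel, ENNReal.iSup_mul]
  -- The kernels increase along the directed family of finite sets, so the supremum moves out of the
  -- finite sum.
  rw [ENNReal.finsetSum_iSup_of_monotone fun y K K' hK => by
    gcongr; exact G.restrictedHeatKernel_mono ht x y hK]
  refine iSup_le fun K => ?_
  by_cases hx : x ∈ K
  · calc ∑ y ∈ F, ENNReal.ofReal (G.restrictedHeatKernel K t x y) * ENNReal.ofReal (G.m y)
        = ENNReal.ofReal (∑ y ∈ F, G.restrictedHeatKernel K t x y * G.m y) := by
          rw [ENNReal.ofReal_sum_of_nonneg fun y _ =>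
            mul_nonneg (G.restrictedHeatKernel_nonneg K ht _ _) (G.m_pos y).le]
          exact Finset.sum_congr rfl fun y _ =>
            (ENNReal.ofReal_mul (G.restrictedHeatKernel_nonneg K ht _ _)).symm
      _ ≤ ENNReal.ofReal (∑ y ∈ K, G.restrictedHeatKernel K t x y * G.m y) := by
          refine ENNReal.ofReal_le_ofReal ?_
          have hK : ∑ y ∈ K, G.restrictedHeatKernel K t x y * G.m y
              = ∑ y ∈ F ∪ K, G.restrictedHeatKernel K t x y * G.m y :=
            Finset.sum_subset Finset.subset_union_right fun y _ hy => by
              simp [restrictedHeatKernel, hy]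
          rw [hK]
          exact Finset.sum_le_sum_of_subset_of_nonneg Finset.subset_union_left fun y _ _ =>
            mul_nonneg (G.restrictedHeatKernel_nonneg K ht _ _) (G.m_pos y).le
      _ ≤ _ := ENNReal.ofReal_le_ofReal
          ((G.sum_restrictedHeatKernel K t ⟨x, hx⟩).trans_le (h K hx))
  · simp [restrictedHeatKernel, hx]

theorem tsum_heatKernel_le_one {t : ℝ} (ht : 0 ≤ t) (x : X) :
    ∑' y, G.heatKernel t x y * ENNReal.ofReal (G.m y) ≤ 1 := by
  simpa using G.tsum_heatKernel_le ht x fun K hx => G.restrictedSemigroup_one_le_one K ht ⟨x, hx⟩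

end WeightedGraph

/-! ### Criteria for incompleteness and for completeness -/

namespace WeightedGraph

variable {X : Type*} (G : WeightedGraph X)

open scoped Matrix Topology

/-- Extending by zero discards the values of `v` off `K`, which enter the Laplacian with a negative
sign. -/
theorem laplacian_le_restrictedLaplacian_mulVec {v : X → ℝ} (hv : ∀ x, 0 ≤ v x)
    (hs : ∀ x, Summable fun y => G.b x y * v y) (K : Finset X) (x : K) :
    G.laplacian v x ≤ (G.restrictedLaplacian K *ᵥ fun y => v y) x := by
  have h1 : ∀ y, G.b x y * (v x - v y) = G.b x y * v x - G.b x y * v y := fun y => mul_sub _ _ _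
  rw [restrictedLaplacian_mulVec, laplacian, tsum_congr h1,
    ((G.b_summable x).mul_right _).tsum_sub (hs x), tsum_mul_right, one_div, inv_mul_eq_div]
  refine div_le_div_of_nonneg_right ?_ (G.m_pos x).le
  rw [Finset.sum_coe_sort K (fun y => G.b x y * v y)]
  exact sub_le_sub_left
    ((hs x).sum_le_tsum K fun y _ => mul_nonneg (G.b_nonneg x y) (hv y)) _

/-- A nonnegative function `v` with `𝓛 v ≥ 1` bounds the expected lifetime. -/
theorem mul_restrictedSemigroup_one_le {v : X → ℝ} (hv : ∀ x, 0 ≤ v x)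
    (hs : ∀ x, Summable fun y => G.b x y * v y) (h : ∀ x, 1 ≤ G.laplacian v x)
    (K : Finset X) (x : K) {t : ℝ} (ht : 0 ≤ t) :
    t * G.restrictedSemigroup K t 1 x ≤ v x := by
  set w : K → ℝ := fun y => v y
  set u := G.restrictedSemigroup K t 1 x
  -- Write `P_s = e^{-s L_K}`. With `u = P_t 1` frozen at the final time, `P_s v + s u` has
  -- derivative `-P_s (L_K v) + P_t 1`, nonpositive on `(0, t)` because `L_K v ≥ 1` and `P_s 1`
  -- decreases in `s`.
  have hd : ∀ s, HasDerivAt (fun s => G.restrictedSemigroup K s w x + s * u)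
      (-G.restrictedSemigroup K s (G.restrictedLaplacian K *ᵥ w) x + 1 * u) s := fun s =>
    (G.hasDerivAt_restrictedSemigroup K w x s).add ((hasDerivAt_id s).mul_const u)
  have hanti : AntitoneOn (fun s => G.restrictedSemigroup K s w x + s * u) (Set.Icc 0 t) := by
    refine antitoneOn_of_deriv_nonpos (convex_Icc 0 t)
      (fun s _ => (hd s).continuousAt.continuousWithinAt)
      (fun s _ => (hd s).differentiableAt.differentiableWithinAt) fun s hs' => ?_
    rw [interior_Icc] at hs'
    rw [(hd s).deriv]
    have h1 : G.restrictedSemigroup K s 1 x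
        ≤ G.restrictedSemigroup K s (G.restrictedLaplacian K *ᵥ w) x :=
      G.restrictedSemigroup_mono K hs'.1.le (fun y => (h y).trans
        (G.laplacian_le_restrictedLaplacian_mulVec hv hs K y)) x
    have h2 : u ≤ G.restrictedSemigroup K s 1 x :=
      G.restrictedSemigroup_one_antitoneOn K x hs'.1.le ht hs'.2.le
    linarith
  have h3 := hanti (Set.left_mem_Icc.2 ht) (Set.right_mem_Icc.2 ht) ht
  have h4 := G.restrictedSemigroup_nonneg K ht (v := w) (fun y => hv y) x
  simp only [restrictedSemigroup_zero, zero_mul, add_zero] at h3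
  linarith

theorem not_stochasticallyComplete_of_one_le_laplacian [Nonempty X] {v : X → ℝ}
    (hv : ∀ x, 0 ≤ v x) (hs : ∀ x, Summable fun y => G.b x y * v y)
    (h : ∀ x, 1 ≤ G.laplacian v x) : ¬ G.StochasticallyComplete := by
  intro hG
  obtain ⟨x⟩ := ‹Nonempty X›
  have ht : 0 < v x + 1 := by linarith [hv x]
  have h1 := G.tsum_heatKernel_le ht.le x (c := v x / (v x + 1)) fun K hx => by
    rw [le_div_iff₀ ht, mul_comm]
    exact G.mul_restrictedSemigroup_one_le hv hs h K ⟨x, hx⟩ ht.le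
  rw [hG x _ ht.le, ENNReal.one_le_ofReal, one_le_div ht] at h1
  linarith

/-- A Caccioppoli inequality on a finite set. -/
theorem neg_sum_cutoff_le (N : Finset X) (z η : X → ℝ) :
    -∑ x ∈ N, ∑ y ∈ N, 2 * (z x * η x ^ 2) * (G.b x y * (z x - z y))
      ≤ ∑ x ∈ N, z x ^ 2 * ∑ y ∈ N, G.b x y * (η x - η y) ^ 2 := by
  have h1 : ∑ x ∈ N, ∑ y ∈ N, 2 * (z x * η x ^ 2) * (G.b x y * (z x - z y))
      = ∑ x ∈ N, ∑ y ∈ N, 2 * (z y * η y ^ 2) * (G.b x y * (z y - z x)) := by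
    rw [Finset.sum_comm]
    simp only [G.b_symm]
  have h2 : ∑ x ∈ N, ∑ y ∈ N, z x ^ 2 * (G.b x y * (η x - η y) ^ 2)
      = ∑ x ∈ N, ∑ y ∈ N, z y ^ 2 * (G.b x y * (η x - η y) ^ 2) := by
    rw [Finset.sum_comm]
    refine Finset.sum_congr rfl fun x _ => Finset.sum_congr rfl fun y _ => ?_
    rw [G.b_symm]; ring
  simp only [Finset.mul_sum]
  have h3 : 0 ≤ ∑ x ∈ N, ∑ y ∈ N, (2 * (z x * η x ^ 2) * (G.b x y * (z x - z y))
      + 2 * (z y * η y ^ 2) * (G.b x y * (z y - z x)) + z x ^ 2 * (G.b x y * (η x - η y) ^ 2)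
      + z y ^ 2 * (G.b x y * (η x - η y) ^ 2)) := by
    refine Finset.sum_nonneg fun x _ => Finset.sum_nonneg fun y _ => ?_
    -- This square form is identically equal to the symmetrized summand, so no constant is lost.
    have h4 : 0 ≤ G.b x y * (2 * (z x * η x - z y * η y) ^ 2
        + (z x - z y) ^ 2 * (η x - η y) ^ 2) :=
      mul_nonneg (G.b_nonneg x y) (by positivity)
    linarith
  simp only [Finset.sum_add_distrib] at h3
  linarith

/-- The deficit `1 - e^{-t L_K} 1` of the restricted semigroup, equal to `1` off `K`. -/
noncomputable def deficit (K : Finset X) (t : ℝ) (x : X) : ℝ :=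
  open Classical in if h : x ∈ K then 1 - G.restrictedSemigroup K t 1 ⟨x, h⟩ else 1

theorem deficit_nonneg (K : Finset X) {t : ℝ} (ht : 0 ≤ t) (x : X) : 0 ≤ G.deficit K t x := by
  unfold deficit
  split_ifs
  · exact sub_nonneg.2 (G.restrictedSemigroup_one_le_one K ht _)
  · exact zero_le_one

theorem deficit_le_one (K : Finset X) {t : ℝ} (ht : 0 ≤ t) (x : X) : G.deficit K t x ≤ 1 := by
  unfold deficit
  split_ifs
  · exact sub_le_self _ (G.restrictedSemigroup_nonneg K ht (fun _ => zero_le_one) _)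
  · exact le_rfl

/-- Constants are annihilated by the formal Laplacian, so the killing term of `L_K` turns into
differences with the boundary value `1`; `N` must contain the neighbors of `x` for these to be
counted. -/
theorem hasDerivAt_deficit {K N : Finset X} (hKN : K ⊆ N) {x : X} (hx : x ∈ K)
    (hN : ∀ y, y ∉ N → G.b x y = 0) (t : ℝ) :
    HasDerivAt (fun s => G.deficit K s x)
      (-(∑ y ∈ N, G.b x y * (G.deficit K t x - G.deficit K t y)) / G.m x) t := by
  have h1 : (fun s => G.deficit K s x) = fun s => 1 - G.restrictedSemigroup K s 1 ⟨x, hx⟩ := by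
    ext s; rw [deficit, dif_pos hx]
  have h2 := (G.hasDerivAt_restrictedSemigroup K 1 ⟨x, hx⟩ t).const_sub 1
  rw [h1]
  refine h2.congr_deriv ?_
  symm
  rw [neg_neg, restrictedSemigroup_laplacian_comm, restrictedLaplacian_mulVec]
  congr 1
  have h3 : ∑ y : K, G.b x y * G.restrictedSemigroup K t 1 y
      = ∑ y ∈ N, G.b x y * (1 - G.deficit K t y) := by
    rw [← Finset.sum_subset hKN fun y _ hy => by simp [deficit, hy], ← Finset.sum_coe_sort K]
    refine Finset.sum_congr rfl fun y _ => ?_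
    rw [deficit, dif_pos y.2, sub_sub_cancel]
  rw [h3, tsum_eq_sum (s := N) hN, Finset.sum_mul, ← Finset.sum_sub_distrib,
    ← Finset.sum_neg_distrib]
  refine Finset.sum_congr rfl fun y _ => ?_
  simp only [deficit, dif_pos hx]
  ring

/-- Gronwall for the cutoff energy `Φ`, which starts at `0` and satisfies `Φ' ≤ A (Φ + 2 δ B)`,
where `B` is the total mass of `ω`. -/
theorem sum_deficit_sq_le (hfin : ∀ x, {y | G.b x y ≠ 0}.Finite) {ω : X → ℝ}
    (hω : ∀ x, 0 < ω x) (hsum : Summable fun x => ω x * G.m x) {A : ℝ} (hA : 0 ≤ A)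
    (hcut : ∀ (x : X) (N : Finset X),
      ∑ y ∈ N, G.b x y * (ω x - ω y) ^ 2 ≤ A * ω x ^ 2 * G.m x)
    {δ : ℝ} (hδ : 0 < δ) {K : Finset X} (hK : ∀ x, x ∉ K → ω x ≤ δ) {t : ℝ} (ht : 0 ≤ t) :
    ∑ x ∈ K, G.deficit K t x ^ 2 * max (ω x - δ) 0 ^ 2 * G.m x
      ≤ 2 * δ * (∑' x, ω x * G.m x) * Real.exp (A * t) := by
  classical
  set N : Finset X := K ∪ K.biUnion fun x => (hfin x).toFinset
  have hKN : K ⊆ N := Finset.subset_union_left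
  have hN : ∀ x ∈ K, ∀ y, y ∉ N → G.b x y = 0 := by
    intro x hx y hy
    by_contra h
    exact hy (Finset.mem_union_right _ (Finset.mem_biUnion.2 ⟨x, hx, by simpa using h⟩))
  set η : X → ℝ := fun x => max (ω x - δ) 0
  have hη : ∀ x, x ∉ K → η x = 0 := fun x hx => max_eq_right (sub_nonpos.2 (hK x hx))
  set B := ∑' x, ω x * G.m x
  have hB : 0 ≤ B := tsum_nonneg fun x => mul_nonneg (hω x).le (G.m_pos x).le
  set Φ : ℝ → ℝ := fun s => ∑ x ∈ K, G.deficit K s x ^ 2 * η x ^ 2 * G.m x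
  set Φ' : ℝ → ℝ := fun s => -∑ x ∈ N, ∑ y ∈ N, 2 * (G.deficit K s x * η x ^ 2) *
    (G.b x y * (G.deficit K s x - G.deficit K s y))
  have hΦ : ∀ s, HasDerivAt Φ (Φ' s) s := by
    intro s
    have h1 : HasDerivAt Φ (∑ x ∈ K, (((2 : ℕ) : ℝ) * G.deficit K s x ^ (2 - 1) *
        (-(∑ y ∈ N, G.b x y * (G.deficit K s x - G.deficit K s y)) / G.m x)) * η x ^ 2
          * G.m x) s :=
      HasDerivAt.fun_sum fun x hx =>
        (((G.hasDerivAt_deficit hKN hx (hN x hx) s).fun_pow 2).mul_const _).mul_const _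
    refine h1.congr_deriv ?_
    symm
    simp only [Φ']
    rw [← Finset.sum_neg_distrib, ← Finset.sum_subset hKN fun x _ hx => by simp [hη x hx]]
    refine Finset.sum_congr rfl fun x _ => ?_
    rw [← Finset.mul_sum]
    have := (G.m_pos x).ne'
    field_simp
    push_cast
    ring
  have hΦ' : ∀ s, 0 ≤ s → Φ' s ≤ A * (Φ s + 2 * δ * B) := by
    intro s hs
    refine (G.neg_sum_cutoff_le N (G.deficit K s) η).trans ?_
    have h1 : ∀ x ∈ N, G.deficit K s x ^ 2 * ∑ y ∈ N, G.b x y * (η x - η y) ^ 2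
        ≤ A * (G.deficit K s x ^ 2 * η x ^ 2 * G.m x + 2 * δ * (ω x * G.m x)) := by
      intro x _
      have h2 : ∑ y ∈ N, G.b x y * (η x - η y) ^ 2 ≤ A * ω x ^ 2 * G.m x := by
        refine le_trans (Finset.sum_le_sum fun y _ => ?_) (hcut x N)
        refine mul_le_mul_of_nonneg_left ?_ (G.b_nonneg x y)
        rw [sq_le_sq]
        have := abs_max_sub_max_le_abs (ω x - δ) (ω y - δ) 0
        rwa [sub_sub_sub_cancel_right] at this
      -- The gradient bound involves `ω²`, not `η²`. The difference is at most `2 δ ω`: summable,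
      -- and small with `δ`.
      have h3 : ω x ^ 2 ≤ η x ^ 2 + 2 * δ * ω x := by
        rcases le_total (ω x) δ with h | h
        · nlinarith [hω x, sq_nonneg (η x)]
        · have : η x = ω x - δ := max_eq_left (sub_nonneg.2 h)
          rw [this]; nlinarith
      have h4 : G.deficit K s x ^ 2 ≤ 1 :=
        pow_le_one₀ (G.deficit_nonneg K hs x) (G.deficit_le_one K hs x)
      calc G.deficit K s x ^ 2 * ∑ y ∈ N, G.b x y * (η x - η y) ^ 2
          ≤ G.deficit K s x ^ 2 * (A * ω x ^ 2 * G.m x) := by gcongr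
        _ ≤ G.deficit K s x ^ 2 * (A * (η x ^ 2 + 2 * δ * ω x) * G.m x) := by
            have := (G.m_pos x).le
            gcongr
        _ = A * (G.deficit K s x ^ 2 * η x ^ 2 * G.m x
              + G.deficit K s x ^ 2 * (2 * δ * (ω x * G.m x))) := by ring
        _ ≤ A * (G.deficit K s x ^ 2 * η x ^ 2 * G.m x + 1 * (2 * δ * (ω x * G.m x))) := by
            have := mul_pos (hω x) (G.m_pos x)
            gcongr
        _ = _ := by ring
    refine (Finset.sum_le_sum h1).trans ?_
    rw [← Finset.mul_sum, Finset.sum_add_distrib, ← Finset.mul_sum]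
    have h5 : ∑ x ∈ N, G.deficit K s x ^ 2 * η x ^ 2 * G.m x = Φ s :=
      (Finset.sum_subset hKN fun x _ hx => by simp [hη x hx]).symm
    have h6 : ∑ x ∈ N, ω x * G.m x ≤ B :=
      hsum.sum_le_tsum N fun x _ => mul_nonneg (hω x).le (G.m_pos x).le
    rw [h5]
    gcongr
  have hd : ∀ s, HasDerivAt (fun s => (Φ s + 2 * δ * B) * Real.exp (-(A * s)))
      (Φ' s * Real.exp (-(A * s)) +
        (Φ s + 2 * δ * B) * (Real.exp (-(A * s)) * (-(A * 1)))) s := fun s =>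
    ((hΦ s).add_const _).mul (((hasDerivAt_id s).const_mul A).neg.exp)
  have hanti : AntitoneOn (fun s => (Φ s + 2 * δ * B) * Real.exp (-(A * s))) (Set.Ici 0) := by
    refine antitoneOn_of_deriv_nonpos (convex_Ici 0)
      (fun s _ => (hd s).continuousAt.continuousWithinAt)
      (fun s _ => (hd s).differentiableAt.differentiableWithinAt) fun s hs => ?_
    rw [interior_Ici] at hs
    rw [(hd s).deriv]
    have := mul_nonneg (sub_nonneg.2 (hΦ' s (le_of_lt hs))) (Real.exp_pos (-(A * s))).le
    linarith
  have h0 : Φ 0 = 0 := by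
    refine Finset.sum_eq_zero fun x hx => ?_
    simp [deficit, hx, restrictedSemigroup_zero]
  have h7 := hanti Set.self_mem_Ici ht ht
  simp only [h0, zero_add, mul_zero, neg_zero, Real.exp_zero, mul_one] at h7
  rw [Real.exp_neg, ← div_eq_mul_inv, div_le_iff₀ (Real.exp_pos _)] at h7
  have : 0 ≤ 2 * δ * B := by positivity
  linarith

/-- A graph is stochastically complete if it carries a positive summable weight, vanishing at
infinity, whose gradient is bounded by a multiple of the weight. -/
theorem stochasticallyComplete_of_weight (hfin : ∀ x, {y | G.b x y ≠ 0}.Finite) {ω : X → ℝ}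
    (hω : ∀ x, 0 < ω x) (hsum : Summable fun x => ω x * G.m x)
    (hω0 : ∀ δ, 0 < δ → {x | δ < ω x}.Finite) {A : ℝ} (hA : 0 ≤ A)
    (hcut : ∀ (x : X) (N : Finset X),
      ∑ y ∈ N, G.b x y * (ω x - ω y) ^ 2 ≤ A * ω x ^ 2 * G.m x) :
    G.StochasticallyComplete := by
  intro x t ht
  refine le_antisymm (G.tsum_heatKernel_le_one ht x) ?_
  set B := ∑' x, ω x * G.m x
  -- For `δ < ω x / 2` the cutoff at `x` is at least `ω x / 2`; squaring gives a factor `4`, and `8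
  -- = 2 * 4`.
  set D := 8 * B * Real.exp (A * t) / (ω x ^ 2 * G.m x)
  have hlim : Tendsto (fun δ : ℝ => ENNReal.ofReal (1 - √(D * δ))) (𝓝[>] 0) (𝓝 1) := by
    have h1 : Continuous fun δ : ℝ => ENNReal.ofReal (1 - √(D * δ)) :=
      ENNReal.continuous_ofReal.comp (by fun_prop)
    have h2 := h1.tendsto 0
    simp only [mul_zero, Real.sqrt_zero, sub_zero, ENNReal.ofReal_one] at h2
    exact h2.mono_left nhdsWithin_le_nhds
  refine le_of_tendsto hlim ?_
  have hx := hω x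
  filter_upwards [Ioo_mem_nhdsGT (half_pos hx)] with δ hδ
  set K := (hω0 δ hδ.1).toFinset
  have hxK : x ∈ K := by
    simp only [K, Set.Finite.mem_toFinset, Set.mem_ofPred_eq]
    linarith [hδ.2]
  have h1 := G.sum_deficit_sq_le hfin hω hsum hA hcut hδ.1 (K := K)
    (fun y hy => by simpa [K] using hy) ht
  have h2 := (Finset.single_le_sum (f := fun x => G.deficit K t x ^ 2 * max (ω x - δ) 0 ^ 2 * G.m x)
    (fun y _ => mul_nonneg (by positivity) (G.m_pos y).le) hxK).trans h1
  have h3 : (ω x / 2) ^ 2 ≤ max (ω x - δ) 0 ^ 2 := by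
    gcongr
    exact le_max_of_le_left (by linarith [hδ.2])
  have hm := G.m_pos x
  have h4 : G.deficit K t x ^ 2 ≤ D * δ := by
    have h5 : G.deficit K t x ^ 2 * (ω x / 2) ^ 2 * G.m x ≤ 2 * δ * B * Real.exp (A * t) :=
      le_trans (by gcongr) h2
    rw [div_mul_eq_mul_div, le_div_iff₀ (by positivity)]
    linarith
  refine le_trans (ENNReal.ofReal_le_ofReal ?_) (G.ofReal_restrictedSemigroup_le K ht ⟨x, hxK⟩)
  have h6 := Real.le_sqrt_of_sq_le h4
  rw [deficit, dif_pos hxK] at h6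
  linarith

end WeightedGraph

/-! ### Radial functions of logarithmic growth, and sums over fibers -/

/-- Increments of a radial function on a graph whose layers have at most cubically growing total
size. -/
noncomputable def radialStep (D : ℕ → ℝ) (C : ℝ) (k : ℕ) : ℝ :=
  max 0 (1 / (k + 1) - D k / (6 * C * (k + 1) ^ 3))

theorem radialStep_nonneg (D : ℕ → ℝ) (C : ℝ) (k : ℕ) : 0 ≤ radialStep D C k := le_max_left _ _

theorem radialStep_le {D : ℕ → ℝ} (hD : ∀ k, 0 ≤ D k) {C : ℝ} (hC : 0 < C) (k : ℕ) :
    radialStep D C k ≤ 1 / (k + 1) := by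
  have := hD k
  exact max_le (by positivity) (sub_le_self _ (by positivity))

theorem radialStep_le_one {D : ℕ → ℝ} (hD : ∀ k, 0 ≤ D k) {C : ℝ} (hC : 0 < C) (k : ℕ) :
    radialStep D C k ≤ 1 :=
  (radialStep_le hD hC k).trans ((div_le_one (by positivity)).2 (by simp))

/-- A positive step forces `D k ≤ 6 C (k + 1)²`, while the step is at most `1 / (k + 1)`. -/
theorem mul_radialStep_sq_le {D : ℕ → ℝ} (hD : ∀ k, 0 ≤ D k) {C : ℝ} (hC : 0 < C) (k : ℕ) :
    D k * radialStep D C k ^ 2 ≤ 6 * C := by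
  rcases le_total (1 / (k + 1) - D k / (6 * C * (k + 1) ^ 3)) 0 with h | h
  · rw [radialStep, max_eq_left h]
    simp [hC.le]
  · have h1 : D k ≤ 6 * C * (k + 1) ^ 2 := by
      rw [sub_nonneg, div_le_div_iff₀ (by positivity) (by positivity)] at h
      have h2 : (0 : ℝ) < k + 1 := by positivity
      nlinarith
    calc D k * radialStep D C k ^ 2 ≤ 6 * C * (k + 1) ^ 2 * (1 / (k + 1)) ^ 2 := by
          gcongr
          · exact radialStep_nonneg D C k
          · exact radialStep_le hD hC k
      _ = 6 * C := by field_simp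

/-- Summation by parts: the increments of `-1 / (k + 1)³` against partial sums of cubic size cost `3
C / (k + 1)` each. The boundary term is kept so that the induction closes. -/
theorem sum_div_cube_le {D : ℕ → ℝ} {C : ℝ} (hC : 0 < C)
    (hW : ∀ r : ℕ, ∑ k ∈ Finset.range r, D k ≤ C * r ^ 3) (r : ℕ) :
    ∑ k ∈ Finset.range r, D k / (k + 1) ^ 3
      ≤ (∑ k ∈ Finset.range r, D k) / (r + 1) ^ 3
        + 3 * C * ∑ k ∈ Finset.range r, (1 : ℝ) / (k + 1) := by
  induction r with
  | zero => simp
  | succ r ih =>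
    rw [Finset.sum_range_succ (fun k => D k / ((k : ℝ) + 1) ^ 3),
      Finset.sum_range_succ (fun k : ℕ => (1 : ℝ) / (k + 1))]
    have hW' := hW (r + 1)
    have h1 : (∑ k ∈ Finset.range r, D k) / ((r : ℝ) + 1) ^ 3 + D r / (r + 1) ^ 3
        = (∑ k ∈ Finset.range (r + 1), D k) / (r + 1) ^ 3 := by
      rw [Finset.sum_range_succ, add_div]
    set W := ∑ k ∈ Finset.range (r + 1), D k
    push_cast at hW' ⊢
    have hr : (0 : ℝ) ≤ r := r.cast_nonneg
    have h2 : W / ((r : ℝ) + 1) ^ 3 - W / (r + 1 + 1) ^ 3 ≤ 3 * C * (1 / (r + 1)) := by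
      have h3 : (0 : ℝ) ≤ 1 / ((r : ℝ) + 1) ^ 3 - 1 / (r + 1 + 1) ^ 3 := by
        rw [sub_nonneg]
        gcongr
        linarith
      have h4 := mul_le_mul_of_nonneg_right hW' h3
      have h5 : ((r : ℝ) + 1) ^ 3 * (1 / ((r : ℝ) + 1) ^ 3 - 1 / (r + 1 + 1) ^ 3)
          ≤ 3 * (1 / (r + 1)) := by
        have h6 : ((r : ℝ) + 1) ^ 3 * (1 / ((r : ℝ) + 1) ^ 3 - 1 / (r + 1 + 1) ^ 3)
            = ((r + 1 + 1) ^ 3 - (r + 1) ^ 3) / (r + 1 + 1) ^ 3 := by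
          field_simp
        rw [h6, mul_one_div, div_le_div_iff₀ (by positivity) (by positivity)]
        nlinarith [pow_nonneg hr 3, pow_nonneg hr 2]
      calc _ = W * (1 / ((r : ℝ) + 1) ^ 3 - 1 / (r + 1 + 1) ^ 3) := by ring
        _ ≤ C * (((r : ℝ) + 1) ^ 3 * (1 / ((r : ℝ) + 1) ^ 3 - 1 / (r + 1 + 1) ^ 3)) := by
            rw [← mul_assoc]; exact h4
        _ ≤ C * (3 * (1 / (r + 1))) := by gcongr
        _ = _ := by ring
    linarith

/-- The constant `6 C` is twice the `3 C` of `sum_div_cube_le`, so the correction consumes half of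
the harmonic sum; the boundary term accounts for `1 / 6`. -/
theorem half_log_le_sum_radialStep {D : ℕ → ℝ} {C : ℝ} (hC : 0 < C)
    (hW : ∀ r : ℕ, ∑ k ∈ Finset.range r, D k ≤ C * r ^ 3) (r : ℕ) :
    Real.log (r + 1) / 2 - 1 / 6 ≤ ∑ k ∈ Finset.range r, radialStep D C k := by
  have h1 := sum_div_cube_le hC hW r
  have h2 : (∑ k ∈ Finset.range r, D k) / ((r : ℝ) + 1) ^ 3 ≤ C := by
    rw [div_le_iff₀ (by positivity)]
    refine (hW r).trans ?_
    gcongr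
    linarith
  have h3 := log_add_one_le_harmonic r
  have h4 : ((harmonic r : ℚ) : ℝ) = ∑ k ∈ Finset.range r, (1 : ℝ) / (k + 1) := by
    simp [harmonic]
  rw [h4] at h3
  push_cast at h3
  have h5 : ∑ k ∈ Finset.range r, ((1 : ℝ) / (k + 1) - D k / (6 * C * (k + 1) ^ 3))
      ≤ ∑ k ∈ Finset.range r, radialStep D C k :=
    Finset.sum_le_sum fun k _ => le_max_right _ _
  have h6 : ∑ k ∈ Finset.range r, ((1 : ℝ) / (k + 1) - D k / (6 * C * (k + 1) ^ 3))
      = ∑ k ∈ Finset.range r, (1 : ℝ) / (k + 1)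
        - 1 / (6 * C) * ∑ k ∈ Finset.range r, D k / (k + 1) ^ 3 := by
    rw [Finset.sum_sub_distrib, Finset.mul_sum]
    congr 1
    refine Finset.sum_congr rfl fun k _ => ?_
    field_simp
  have h7 : 1 / (6 * C) * ∑ k ∈ Finset.range r, D k / ((k : ℝ) + 1) ^ 3
      ≤ 1 / (6 * C) * (C + 3 * C * ∑ k ∈ Finset.range r, (1 : ℝ) / (k + 1)) := by
    gcongr
    linarith
  have h8 : 1 / (6 * C) * (C + 3 * C * ∑ k ∈ Finset.range r, (1 : ℝ) / (k + 1))
      = 1 / 6 + (∑ k ∈ Finset.range r, (1 : ℝ) / (k + 1)) / 2 := by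
    field_simp
    ring
  linarith

theorem abs_exp_sub_one_le_mul_exp_abs (u : ℝ) : |Real.exp u - 1| ≤ |u| * Real.exp |u| := by
  have h1 := Real.add_one_le_exp u
  have h2 : Real.exp u - 1 ≤ u * Real.exp u := by
    have h3 := mul_le_mul_of_nonneg_left (Real.add_one_le_exp (-u)) (Real.exp_pos u).le
    rw [← Real.exp_add, add_neg_cancel, Real.exp_zero] at h3
    linarith
  rcases le_total 0 u with h | h
  · rw [abs_of_nonneg h, abs_of_nonneg (by linarith)]
    exact h2
  · have h4 : |u| ≤ |u| * Real.exp |u| :=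
      le_mul_of_one_le_right (abs_nonneg u) (Real.one_le_exp (abs_nonneg u))
    rw [abs_of_nonpos h] at h4 ⊢
    rw [abs_of_nonpos (by have := Real.exp_le_one_iff.2 h; linarith)]
    linarith

theorem summable_comp_of_card_fiber_le {X : Type*} {d : X → ℕ} (hd : ∀ r, {x | d x = r}.Finite)
    {g : ℕ → ℝ} (hg : ∀ r, 0 ≤ g r) (h : Summable fun r => ({x | d x = r}.ncard : ℝ) * g r) :
    Summable fun x => g (d x) := by
  refine summable_of_sum_le (c := ∑' r, ({x | d x = r}.ncard : ℝ) * g r) (fun x => hg _) fun F => ?_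
  rw [← Finset.sum_fiberwise_of_maps_to (s := F) (t := F.image d) (g := d)
    (fun x hx => Finset.mem_image_of_mem d hx)]
  refine le_trans (Finset.sum_le_sum fun r _ => ?_)
    (h.sum_le_tsum (F.image d) fun r _ => mul_nonneg (Nat.cast_nonneg _) (hg r))
  rw [Finset.sum_congr rfl (g := fun _ => g r) fun x hx => by rw [(Finset.mem_filter.1 hx).2],
    Finset.sum_const, nsmul_eq_mul]
  refine mul_le_mul_of_nonneg_right ?_ (hg r)
  rw [← Set.ncard_coe_finset, Nat.cast_le]
  exact Set.ncard_le_ncard (fun x hx => (Finset.mem_filter.1 (Finset.mem_coe.1 hx)).2) (hd r)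

theorem sum_ite_le_ncard_mul {X : Type*} {d : X → ℕ} {j : ℕ} (hd : {x | d x = j}.Finite)
    {c : ℝ} (hc : 0 ≤ c) (N : Finset X) :
    ∑ y ∈ N, (if d y = j then c else 0) ≤ ({x | d x = j}.ncard : ℝ) * c := by
  rw [← Finset.sum_filter, Finset.sum_const, nsmul_eq_mul]
  refine mul_le_mul_of_nonneg_right ?_ hc
  rw [← Set.ncard_coe_finset, Nat.cast_le]
  exact Set.ncard_le_ncard (fun x hx => (Finset.mem_filter.1 (Finset.mem_coe.1 hx)).2) hd

theorem sum_range_ncard_fiber {X : Type*} {d : X → ℕ} (hd : ∀ r, {x | d x ≤ r}.Finite) (r : ℕ) :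
    ∑ k ∈ Finset.range (r + 1), {x | d x = k}.ncard = {x | d x ≤ r}.ncard := by
  rw [Set.ncard_eq_toFinset_card _ (hd r), Finset.card_eq_sum_card_fiberwise (f := d)
    (t := Finset.range (r + 1)) fun x hx => by
      simpa [Nat.lt_succ_iff] using hx]
  refine Finset.sum_congr rfl fun k hk => ?_
  rw [← Set.ncard_coe_finset]
  congr 1
  ext x
  have := Finset.mem_range.1 hk
  simp only [Set.mem_ofPred_eq, Finset.coe_filter, Set.Finite.mem_toFinset]
  omega

/-! ### Completeness under cubic volume growth -/

namespace WeightedGraph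

variable {X : Type*} (G : WeightedGraph X)

/-- A graph with standard weights and counting measure is stochastically complete if it carries an
integer valued function, varying by at most one along edges, with sublevel sets of at most cubic
size. -/
theorem stochasticallyComplete_of_cubic_sublevel (hstd : G.HasStandardWeights)
    (hm : G.HasCountingMeasure) {d : X → ℕ} (hadj : ∀ x y, G.b x y ≠ 0 → d y ≤ d x + 1)
    (hfin : ∀ r, {x | d x ≤ r}.Finite) {C : ℝ} (hC : 0 < C)
    (hcard : ∀ r : ℕ, ({x | d x ≤ r}.ncard : ℝ) ≤ C * (r + 1) ^ 3) : G.StochasticallyComplete := by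
  set s : ℕ → ℝ := fun k => ({x | d x = k}.ncard : ℝ)
  have hs : ∀ k, 0 ≤ s k := fun k => Nat.cast_nonneg _
  have hfib : ∀ r, {x | d x = r}.Finite := fun r => (hfin r).subset fun x hx => le_of_eq hx
  have hsum : ∀ r : ℕ, ∑ k ∈ Finset.range (r + 1), s k ≤ C * (r + 1) ^ 3 := fun r => by
    refine le_trans (le_of_eq ?_) (hcard r)
    rw [← sum_range_ncard_fiber hfin r]
    push_cast
    rfl
  set D : ℕ → ℝ := fun k => s k + s (k + 1)
  have hD : ∀ k, 0 ≤ D k := fun k => add_nonneg (hs _) (hs _)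
  -- Each of the two sums making up `∑ D` is at most `C (r + 1)³ ≤ 8 C r³` for `r ≥ 1`.
  set M := 16 * C
  have hM : 0 < M := by positivity
  have hW : ∀ r : ℕ, ∑ k ∈ Finset.range r, D k ≤ M * r ^ 3 := by
    intro r
    rcases Nat.eq_zero_or_pos r with rfl | hr
    · simp
    · have h1 := hsum r
      have h2 : ∑ k ∈ Finset.range r, s k ≤ ∑ k ∈ Finset.range (r + 1), s k := by
        rw [Finset.sum_range_succ]; linarith [hs r]
      have h3 : ∑ k ∈ Finset.range r, s (k + 1) ≤ ∑ k ∈ Finset.range (r + 1), s k := by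
        rw [Finset.sum_range_succ']; linarith [hs 0]
      have h4 : (1 : ℝ) ≤ r := by exact_mod_cast hr
      have h5 : C * ((r : ℝ) + 1) ^ 3 ≤ C * (2 * r) ^ 3 := by
        gcongr
        linarith
      rw [Finset.sum_add_distrib]
      calc _ ≤ 2 * (C * (2 * (r : ℝ)) ^ 3) := by linarith
        _ = M * r ^ 3 := by ring
  set σ := radialStep D M
  set h : ℕ → ℝ := fun r => ∑ k ∈ Finset.range r, σ k
  have hσ0 : ∀ k, 0 ≤ σ k := radialStep_nonneg D M
  have hσ1 : ∀ k, σ k ≤ 1 := radialStep_le_one hD hM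
  have hσD : ∀ k, D k * σ k ^ 2 ≤ 6 * M := mul_radialStep_sq_le hD hM
  have hsucc : ∀ k, h (k + 1) = h k + σ k := fun k => Finset.sum_range_succ _ _
  -- Since `h` is at least half a logarithm, the factor `10` gives decay of order `(r + 1)⁻⁵`,
  -- summable against spheres crudely bounded by `C (r + 1)³`.
  set g : ℕ → ℝ := fun r => Real.exp (-(10 * h r))
  have hg : ∀ r, g r ≤ Real.exp (5 / 3) * ((r : ℝ) + 1) ^ (-5 : ℝ) := by
    intro r
    rw [Real.rpow_def_of_pos (by positivity), ← Real.exp_add]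
    refine Real.exp_le_exp.2 ?_
    have := half_log_le_sum_radialStep hM hW r
    linarith
  have hsg : Summable fun r => s r * g r := by
    have h1 : Summable fun r : ℕ => C * Real.exp (5 / 3) * (1 / ((r + 1 : ℕ) : ℝ) ^ 2) :=
      ((summable_nat_add_iff 1).2 (Real.summable_one_div_nat_pow.2 one_lt_two)).mul_left _
    refine h1.of_nonneg_of_le (fun r => mul_nonneg (hs r) (Real.exp_nonneg _)) fun r => ?_
    have h2 : s r ≤ C * (r + 1) ^ 3 :=
      (Finset.single_le_sum (f := s) (fun k _ => hs k) (Finset.self_mem_range_succ r)).trans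
        (hsum r)
    calc s r * g r ≤ C * (r + 1) ^ 3 * (Real.exp (5 / 3) * ((r : ℝ) + 1) ^ (-5 : ℝ)) :=
          mul_le_mul h2 (hg r) (Real.exp_nonneg _) (by positivity)
      _ = _ := by
          rw [Real.rpow_neg (by positivity)]
          norm_cast
          push_cast
          field_simp
  have hgd : Summable fun x => g (d x) :=
    summable_comp_of_card_fiber_le hfib (fun r => Real.exp_nonneg _) hsg
  refine G.stochasticallyComplete_of_weight (ω := fun x => g (d x))
    (A := 100 * Real.exp 20 * (12 * M)) (fun x => (hfin (d x + 1)).subset fun y hy => hadj x y hy)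
    (fun x => Real.exp_pos _) (by simpa only [hm _, mul_one] using hgd) (fun δ hδ => ?_)
    (by positivity) fun x N => ?_
  · have h1 := hgd.tendsto_cofinite_zero.eventually (gt_mem_nhds hδ)
    refine Set.Finite.subset (eventually_cofinite.1 h1) fun x hx => ?_
    exact not_lt.2 (le_of_lt hx)
  · rw [hm x, mul_one]
    -- Only neighbors in the two adjacent spheres contribute. At `d x = 0` the truncated index `d x
    -- - 1` is harmless, its condition being false.
    have hb : ∀ y, G.b x y * (h (d x) - h (d y)) ^ 2
        ≤ (if d y = d x + 1 then σ (d x) ^ 2 else 0)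
          + (if d y + 1 = d x then σ (d x - 1) ^ 2 else 0) := by
      intro y
      rcases hstd x y with hxy | hxy
      · rw [hxy, zero_mul]
        positivity
      · have h1 := hadj x y (by rw [hxy]; exact one_ne_zero)
        have h2 := hadj y x (by rw [G.b_symm, hxy]; exact one_ne_zero)
        rw [hxy, one_mul]
        rcases Nat.lt_trichotomy (d y) (d x) with h3 | h3 | h3
        · have h4 : d y + 1 = d x := by omega
          rw [if_neg (by omega), if_pos h4, ← h4, hsucc]
          simp
        · simp [h3]
        · have h4 : d y = d x + 1 := by omega
          rw [if_pos h4, if_neg (by omega), h4, hsucc]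
          simp
    have hle : ∀ y, G.b x y ≠ 0 → |h (d x) - h (d y)| ≤ 1 := by
      intro y hxy
      have h1 := hadj x y hxy
      have h2 := hadj y x (by rwa [G.b_symm])
      rcases Nat.lt_trichotomy (d y) (d x) with h3 | h3 | h3
      · have h4 : d x = d y + 1 := by omega
        rw [h4, hsucc, add_sub_cancel_left, abs_of_nonneg (hσ0 _)]
        exact hσ1 _
      · simp [h3]
      · have h4 : d y = d x + 1 := by omega
        rw [h4, hsucc, sub_add_cancel_left, abs_neg, abs_of_nonneg (hσ0 _)]
        exact hσ1 _
    have hgrad : ∀ y, G.b x y * (g (d x) - g (d y)) ^ 2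
        ≤ 100 * Real.exp 20 * g (d x) ^ 2 * (G.b x y * (h (d x) - h (d y)) ^ 2) := by
      intro y
      by_cases hxy : G.b x y = 0
      · simp [hxy]
      · set u := h (d x) - h (d y)
        have h1 : g (d y) = g (d x) * Real.exp (10 * u) := by
          rw [← Real.exp_add]
          exact congrArg Real.exp (by ring)
        have h2 := abs_exp_sub_one_le_mul_exp_abs (10 * u)
        have h3 : |10 * u| ≤ 10 := by
          rw [abs_mul, abs_of_pos (by norm_num : (0 : ℝ) < 10)]
          linarith [hle y hxy]
        have h4 : (Real.exp (10 * u) - 1) ^ 2 ≤ 100 * u ^ 2 * Real.exp 20 := by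
          calc (Real.exp (10 * u) - 1) ^ 2 = |Real.exp (10 * u) - 1| ^ 2 := (sq_abs _).symm
            _ ≤ (|10 * u| * Real.exp 10) ^ 2 := by
                gcongr
                exact h2.trans (by gcongr)
            _ = 100 * u ^ 2 * Real.exp 20 := by
                rw [mul_pow, sq_abs, ← Real.exp_nat_mul]
                norm_num
                ring
        have h5 := G.b_nonneg x y
        calc G.b x y * (g (d x) - g (d y)) ^ 2
            = G.b x y * (g (d x) ^ 2 * (Real.exp (10 * u) - 1) ^ 2) := by rw [h1]; ring
          _ ≤ G.b x y * (g (d x) ^ 2 * (100 * u ^ 2 * Real.exp 20)) := by gcongr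
          _ = _ := by ring
    have hbsum : ∑ y ∈ N, G.b x y * (h (d x) - h (d y)) ^ 2 ≤ 12 * M := by
      refine (Finset.sum_le_sum fun y _ => hb y).trans ?_
      rw [Finset.sum_add_distrib]
      have h1 : ∑ y ∈ N, (if d y = d x + 1 then σ (d x) ^ 2 else 0) ≤ 6 * M := by
        refine (sum_ite_le_ncard_mul (hfib _) (sq_nonneg _) N).trans (le_trans ?_ (hσD (d x)))
        exact mul_le_mul_of_nonneg_right (le_add_of_nonneg_left (hs _)) (sq_nonneg _)
      have h2 : ∑ y ∈ N, (if d y + 1 = d x then σ (d x - 1) ^ 2 else 0) ≤ 6 * M := by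
        rcases Nat.eq_zero_or_pos (d x) with h3 | h3
        · simp only [h3, Nat.succ_ne_zero, if_false, Finset.sum_const_zero]
          positivity
        · have h4 : ∀ y, d y + 1 = d x ↔ d y = d x - 1 := fun y => by omega
          simp only [h4]
          refine (sum_ite_le_ncard_mul (hfib _) (sq_nonneg _) N).trans
            (le_trans ?_ (hσD (d x - 1)))
          exact mul_le_mul_of_nonneg_right (le_add_of_nonneg_right (hs _)) (sq_nonneg _)
      linarith
    calc ∑ y ∈ N, G.b x y * (g (d x) - g (d y)) ^ 2
        ≤ ∑ y ∈ N, 100 * Real.exp 20 * g (d x) ^ 2 * (G.b x y * (h (d x) - h (d y)) ^ 2) :=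
          Finset.sum_le_sum fun y _ => hgrad y
      _ = 100 * Real.exp 20 * g (d x) ^ 2 * ∑ y ∈ N, G.b x y * (h (d x) - h (d y)) ^ 2 := by
          rw [Finset.mul_sum]
      _ ≤ 100 * Real.exp 20 * g (d x) ^ 2 * (12 * M) := by gcongr
      _ = _ := by ring

theorem measure_eq_encard (hm : G.HasCountingMeasure) (A : Set X) : G.measure A = A.encard := by
  simp only [measure, hm _, ENNReal.ofReal_one, ENNReal.tsum_set_one]

theorem adj_of_ne_zero {x y : X} (h : G.b x y ≠ 0) : G.toSimpleGraph.Adj x y :=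
  lt_of_le_of_ne (G.b_nonneg x y) h.symm

theorem ball_mono (x₀ : X) : Monotone (G.ball x₀) := by
  intro r s hrs x (hx : G.toSimpleGraph.edist x x₀ ≤ r)
  exact hx.trans (Nat.cast_le.2 hrs)

/-- Cubic volume growth implies stochastic completeness. -/
theorem stochasticallyComplete_of_vol_le (hstd : G.HasStandardWeights)
    (hm : G.HasCountingMeasure) (hconn : G.Connected) (x₀ : X) {C : ℝ} (hC : 0 < C)
    (hvol : ∀ᶠ r : ℕ in atTop, G.vol x₀ r ≤ ENNReal.ofReal (C * (r : ℝ) ^ 3)) :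
    G.StochasticallyComplete := by
  replace hconn : G.toSimpleGraph.Connected := hconn
  obtain ⟨R, hR⟩ := eventually_atTop.1 hvol
  set d : X → ℕ := fun x => G.toSimpleGraph.dist x x₀
  have hball : ∀ r, G.ball x₀ r = {x | d x ≤ r} := by
    intro r
    ext x
    change G.toSimpleGraph.edist x x₀ ≤ r ↔ G.toSimpleGraph.dist x x₀ ≤ r
    rw [← (hconn.preconnected x x₀).coe_dist_eq_edist, Nat.cast_le]
  -- Enlarging the constant by `(R + 1)³` extends the bound from large `r` to every `r`, as `max r R
  -- ≤ (R + 1) (r + 1)`.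
  have hle : ∀ r : ℕ, ({x | d x ≤ r}.encard : ℝ≥0∞)
      ≤ ENNReal.ofReal (C * (R + 1) ^ 3 * (r + 1) ^ 3) := by
    intro r
    rw [← hball, ← G.measure_eq_encard hm]
    have h1 : G.measure (G.ball x₀ r) ≤ G.vol x₀ (max r R) := by
      rw [vol, G.measure_eq_encard hm, G.measure_eq_encard hm]
      exact_mod_cast Set.encard_le_encard (G.ball_mono x₀ (le_max_left r R))
    refine (h1.trans (hR _ (le_max_right r R))).trans (ENNReal.ofReal_le_ofReal ?_)
    rw [mul_assoc, ← mul_pow]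
    gcongr
    have : max r R ≤ (R + 1) * (r + 1) := max_le (by nlinarith) (by nlinarith)
    exact_mod_cast this
  have hfin : ∀ r, {x | d x ≤ r}.Finite := by
    intro r
    rw [← Set.encard_lt_top_iff]
    have := (hle r).trans_lt ENNReal.ofReal_lt_top
    exact_mod_cast this
  refine G.stochasticallyComplete_of_cubic_sublevel hstd hm (d := d) (fun x y hxy => ?_) hfin
    (C := C * (R + 1) ^ 3) (by positivity) fun r => ?_
  · have h1 := hconn.dist_triangle (u := y) (v := x) (w := x₀)
    rw [SimpleGraph.dist_eq_one_iff_adj.2 (G.adj_of_ne_zero hxy).symm] at h1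
    change G.toSimpleGraph.dist y x₀ ≤ G.toSimpleGraph.dist x x₀ + 1
    omega
  · have h1 := hle r
    rw [← (hfin r).cast_ncard_eq] at h1
    have h2 : ((({x | d x ≤ r}.ncard : ℕ∞)) : ℝ≥0∞) = (({x | d x ≤ r}.ncard : ℝ≥0∞)) := by
      norm_cast
    rw [h2, ← ENNReal.ofReal_natCast, ENNReal.ofReal_le_ofReal_iff (by positivity)] at h1
    exact h1

end WeightedGraph

/-! ### Sequences of power order and their partial sums -/

theorem exists_forall_rpow_bounds_of_isOfOrder {a : ℕ → ℕ} (ha : ∀ r, 0 < a r) {p : ℝ} (hp : 0 ≤ p)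
    (h : IsOfOrder (fun r => (a r : ℝ≥0∞)) p) :
    ∃ c C : ℝ, 0 < c ∧ 0 < C ∧
      ∀ r : ℕ, c * ((r : ℝ) + 1) ^ p ≤ a r ∧ (a r : ℝ) ≤ C * ((r : ℝ) + 1) ^ p := by
  obtain ⟨c, C, hc, hC, h⟩ := h
  obtain ⟨R, hR⟩ := eventually_atTop.1 h
  -- For large `r` the lower constant uses `r ≥ (r + 1) / 2`, for the remaining `r` it uses `a r ≥
  -- 1`; the finite sum in the upper constant dominates the early terms.
  refine ⟨min (c * (1 / 2) ^ p) (((R : ℝ) + 1 + 1) ^ p)⁻¹, C + ∑ j ∈ Finset.range R, (a j : ℝ),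
    by positivity, by positivity, fun r => ⟨?_, ?_⟩⟩
  · rcases le_or_gt (R + 1) r with hr | hr
    · have h1 := (hR r (by omega)).1
      beta_reduce at h1
      rw [← ENNReal.ofReal_natCast, ENNReal.ofReal_le_ofReal_iff (Nat.cast_nonneg _)] at h1
      have h2 : (1 : ℝ) ≤ r := by exact_mod_cast (by omega : 1 ≤ r)
      calc _ ≤ c * (1 / 2) ^ p * ((r : ℝ) + 1) ^ p := by
            gcongr
            exact min_le_left _ _
        _ = c * (1 / 2 * ((r : ℝ) + 1)) ^ p := by
            rw [Real.mul_rpow (by norm_num) (by positivity), mul_assoc]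
        _ ≤ c * (r : ℝ) ^ p := by
            gcongr
            linarith
        _ ≤ _ := h1
    · have h2 : (r : ℝ) ≤ R + 1 := by exact_mod_cast hr.le
      calc _ ≤ (((R : ℝ) + 1 + 1) ^ p)⁻¹ * ((R : ℝ) + 1 + 1) ^ p := by
            gcongr
            exact min_le_right _ _
        _ = 1 := inv_mul_cancel₀ (by positivity)
        _ ≤ a r := by exact_mod_cast ha r
  · rcases le_or_gt R r with hr | hr
    · have h1 := (hR r hr).2
      beta_reduce at h1
      rw [← ENNReal.ofReal_natCast, ENNReal.ofReal_le_ofReal_iff (by positivity)] at h1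
      refine h1.trans ?_
      gcongr
      · exact le_add_of_nonneg_right (Finset.sum_nonneg fun _ _ => Nat.cast_nonneg _)
      · linarith
    · have h1 := Finset.single_le_sum (f := fun j => (a j : ℝ)) (fun _ _ => Nat.cast_nonneg _)
        (Finset.mem_range.2 hr)
      have h2 : 1 ≤ ((r : ℝ) + 1) ^ p := Real.one_le_rpow (by simp) hp
      calc (a r : ℝ) ≤ ∑ j ∈ Finset.range R, (a j : ℝ) := h1
        _ ≤ C + ∑ j ∈ Finset.range R, (a j : ℝ) := by linarith
        _ ≤ _ := le_mul_of_one_le_right (by positivity) h2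

theorem sum_range_le_rpow {a : ℕ → ℝ} {p C : ℝ} (hp : 0 ≤ p) (hC : 0 ≤ C)
    (h : ∀ r : ℕ, a r ≤ C * ((r : ℝ) + 1) ^ p) (r : ℕ) :
    ∑ j ∈ Finset.range (r + 1), a j ≤ C * ((r : ℝ) + 1) ^ (p + 1) := by
  have h1 : ∀ j ∈ Finset.range (r + 1), a j ≤ C * ((r : ℝ) + 1) ^ p := fun j hj => by
    refine (h j).trans ?_
    have : (j : ℝ) ≤ r := by exact_mod_cast Nat.lt_succ_iff.1 (Finset.mem_range.1 hj)
    gcongr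
  refine (Finset.sum_le_card_nsmul _ _ _ h1).trans (le_of_eq ?_)
  rw [Finset.card_range, nsmul_eq_mul, Real.rpow_add_one (by positivity)]
  push_cast
  ring

/-- Pair `j` with `r - j`: the larger of the two is at least `r / 2`, so each pair contributes at
least `c ((r + 1) / 2) ^ p`. -/
theorem le_sum_range_rpow {a : ℕ → ℝ} {p c : ℝ} (hp : 0 ≤ p) (hc : 0 ≤ c)
    (h : ∀ r : ℕ, c * ((r : ℝ) + 1) ^ p ≤ a r) (r : ℕ) :
    c * (1 / 2) ^ (p + 1) * ((r : ℝ) + 1) ^ (p + 1) ≤ ∑ j ∈ Finset.range (r + 1), a j := by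
  have hnn : ∀ j, 0 ≤ a j := fun j => le_trans (by positivity) (h j)
  have h1 : ∀ j ∈ Finset.range (r + 1),
      c * (1 / 2 * ((r : ℝ) + 1)) ^ p ≤ a j + a (r + 1 - 1 - j) := fun j hj => by
    have hj' : j ≤ r := Nat.lt_succ_iff.1 (Finset.mem_range.1 hj)
    rcases le_total r (2 * j) with h2 | h2
    · have h3 : (r : ℝ) ≤ 2 * j := by exact_mod_cast h2
      refine le_trans ?_ ((h j).trans (le_add_of_nonneg_right (hnn _)))
      gcongr
      linarith
    · have h3 : 2 * (j : ℝ) ≤ r := by exact_mod_cast h2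
      refine le_trans ?_ ((h _).trans (le_add_of_nonneg_left (hnn _)))
      rw [Nat.add_sub_cancel, Nat.cast_sub hj']
      gcongr
      linarith
  have h2 := Finset.card_nsmul_le_sum _ _ _ h1
  rw [Finset.sum_add_distrib, Finset.sum_range_reflect, Finset.card_range, nsmul_eq_mul] at h2
  push_cast at h2
  have h3 : c * (1 / 2) ^ (p + 1) * ((r : ℝ) + 1) ^ (p + 1)
      = 1 / 2 * (((r : ℝ) + 1) * (c * (1 / 2 * ((r : ℝ) + 1)) ^ p)) := by
    rw [mul_assoc, ← Real.mul_rpow (by norm_num) (by positivity),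
      Real.rpow_add_one (by positivity)]
    ring
  linarith

theorem hasSum_ite_fiber {X : Type*} {l : X → ℕ} {j : ℕ} (hl : {x | l x = j}.Finite) (c : ℝ) :
    HasSum (fun y => if l y = j then c else 0) ({x | l x = j}.ncard * c) := by
  have h : HasSum (fun y => if l y = j then c else 0)
      (∑ y ∈ hl.toFinset, if l y = j then c else 0) := hasSum_sum_of_ne_finset_zero
    fun y hy => if_neg (by simpa using hy)
  convert h using 1
  rw [Set.ncard_eq_toFinset_card _ hl, ← nsmul_eq_mul, ← Finset.sum_const]
  exact Finset.sum_congr rfl fun y hy => (if_pos (by simpa using hy)).symm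

/-! ### Anti-trees: connectedness, volume growth and incompleteness -/

namespace WeightedGraph

variable {X : Type*} {G : WeightedGraph X} {a : ℕ → ℕ}

theorem IsAntiTree.exists_level (h : G.IsAntiTree a) :
    ∃ l : X → ℕ, (∀ r, {x | l x = r}.encard = a r) ∧
      ∀ x y, G.b x y = if l y = l x + 1 ∨ l x = l y + 1 then 1 else 0 := by
  obtain ⟨A, hdisj, hcov, hmeas, hb⟩ := h.layers
  have hex : ∀ x, ∃ r, x ∈ A r := fun x => Set.mem_iUnion.1 (hcov ▸ Set.mem_univ x)
  choose l hl using hex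
  have hmem : ∀ x r, x ∈ A r ↔ l x = r := by
    refine fun x r => ⟨fun hx => ?_, fun hx => hx ▸ hl x⟩
    by_contra hne
    exact Set.disjoint_left.1 (hdisj hne) (hl x) hx
  refine ⟨l, fun r => ?_, fun x y => ?_⟩
  · have h1 := hmeas r
    rw [G.measure_eq_encard h.counting] at h1
    have h2 : {x | l x = r} = A r := Set.ext fun x => (hmem x r).symm
    rw [h2]
    exact_mod_cast h1
  · have h1 : G.b x y = 1 ↔ (l y = l x + 1 ∨ l x = l y + 1) := by
      rw [hb]
      simp only [hmem]
      constructor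
      · rintro ⟨r, h | h⟩ <;> omega
      · rintro (h | h)
        · exact ⟨l x, Or.inl ⟨rfl, h⟩⟩
        · exact ⟨l y, Or.inr ⟨rfl, h⟩⟩
    split_ifs with h2
    · exact h1.2 h2
    · exact (h.standard x y).resolve_right fun h3 => h2 (h1.1 h3)

section Level

variable {l : X → ℕ} (hl : ∀ r, {x | l x = r}.encard = a r)
  (hb : ∀ x y, G.b x y = if l y = l x + 1 ∨ l x = l y + 1 then 1 else 0)

include hb in
theorem adj_iff_of_level {x y : X} :
    G.toSimpleGraph.Adj x y ↔ l y = l x + 1 ∨ l x = l y + 1 := by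
  change 0 < G.b x y ↔ _
  rw [hb]
  split_ifs with h <;> simp [h]

include hl in
theorem finite_level (r : ℕ) : {x | l x = r}.Finite := by
  rw [← Set.encard_lt_top_iff, hl]
  exact ENat.natCast_lt_top _

include hl in
theorem ncard_level (r : ℕ) : {x | l x = r}.ncard = a r := by
  have h := (finite_level hl r).cast_ncard_eq
  rw [hl] at h
  exact_mod_cast h

include hl in
theorem finite_sublevel (r : ℕ) : {x | l x ≤ r}.Finite :=
  ((Set.finite_le_nat r).biUnion fun k _ => finite_level hl k).subset fun x hx =>
    Set.mem_biUnion (x := l x) hx rfl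

include hl in
theorem ncard_sublevel (r : ℕ) : {x | l x ≤ r}.ncard = ∑ j ∈ Finset.range (r + 1), a j := by
  rw [← sum_range_ncard_fiber (finite_sublevel hl)]
  exact Finset.sum_congr rfl fun k _ => ncard_level hl k

include hl hb in
-- Every level is nonempty and completely joined to the next, so one can descend a level at each
-- step; `a 0 = 1` makes the descent end at `o`.
theorem edist_root_le (ha0 : a 0 = 1) (ha : ∀ r, 0 < a r) {o : X} (ho : l o = 0) (x : X) :
    G.toSimpleGraph.edist x o ≤ l x := by
  induction hr : l x generalizing x with
  | zero =>
    have h1 : {x | l x = 0}.encard ≤ 1 := by rw [hl, ha0]; rfl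
    rw [Set.encard_le_one_iff.1 h1 x o hr ho]
    simp
  | succ r ih =>
    have h1 : {x | l x = r}.Nonempty := by
      rw [← Set.encard_pos, hl]
      exact_mod_cast ha r
    obtain ⟨y, hy⟩ := h1
    replace hy : l y = r := hy
    have h2 : G.toSimpleGraph.Adj x y := (adj_iff_of_level hb).2 (Or.inr (by omega))
    refine (SimpleGraph.edist_triangle (v := y)).trans ?_
    rw [SimpleGraph.edist_eq_one_iff_adj.2 h2, add_comm, Nat.cast_add, Nat.cast_one]
    gcongr
    exact ih y hy

include hb in
theorem level_le_of_edist_le {x y : X} {n : ℕ} (h : G.toSimpleGraph.edist x y ≤ n) :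
    l x ≤ l y + n := by
  obtain ⟨p, hp⟩ := SimpleGraph.exists_walk_of_edist_ne_top (ne_top_of_le_ne_top (by simp) h)
  rw [← hp, Nat.cast_le] at h
  refine le_trans ?_ (Nat.add_le_add_left h (l y))
  clear h hp
  induction p with
  | nil => simp
  | cons hadj p ih =>
    rw [SimpleGraph.Walk.length_cons]
    have := (adj_iff_of_level hb).1 hadj
    omega

include hl in
theorem exists_root (ha0 : a 0 = 1) : ∃ o : X, l o = 0 := by
  have h1 : {x | l x = 0}.Nonempty := by
    rw [← Set.encard_pos, hl, ha0]
    simp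
  exact h1

include hl hb in
theorem connected_of_level (ha0 : a 0 = 1) (ha : ∀ r, 0 < a r) : G.Connected := by
  obtain ⟨o, ho⟩ := exists_root hl ha0
  have h1 : ∀ x, G.toSimpleGraph.Reachable x o := fun x =>
    SimpleGraph.reachable_of_edist_ne_top
      (ne_top_of_le_ne_top (by simp) (edist_root_le hl hb ha0 ha ho x))
  have : Nonempty X := ⟨o⟩
  exact SimpleGraph.Connected.mk fun x y => (h1 x).trans (h1 y).symm

include hl hb in
theorem vol_isOfOrder_of_level (hm : G.HasCountingMeasure) (ha0 : a 0 = 1) (ha : ∀ r, 0 < a r)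
    {p c C : ℝ} (hp : 0 ≤ p) (hc : 0 < c) (hC : 0 < C)
    (hac : ∀ r : ℕ, c * ((r : ℝ) + 1) ^ p ≤ a r)
    (haC : ∀ r : ℕ, (a r : ℝ) ≤ C * ((r : ℝ) + 1) ^ p) (x₀ : X) :
    IsOfOrder (G.vol x₀) (p + 1) := by
  obtain ⟨o, ho⟩ := exists_root hl ha0
  have hV : ∀ r : ℕ, ({x | l x ≤ r}.encard : ℝ≥0∞)
      = ENNReal.ofReal (∑ j ∈ Finset.range (r + 1), (a j : ℝ)) := by
    intro r
    rw [← (finite_sublevel hl r).cast_ncard_eq, ncard_sublevel hl, ← Nat.cast_sum,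
      ENNReal.ofReal_natCast]
    norm_cast
  refine ⟨c * (1 / 2) ^ (p + 1) * (1 / 2) ^ (p + 1), C * 2 ^ (p + 1), by positivity, by positivity,
    ?_⟩
  -- The ball lies between the sublevel sets of heights `r - l x₀` and `r + l x₀`; the threshold
  -- makes these heights, plus one, at least `r / 2` and at most `2 r`.
  filter_upwards [eventually_ge_atTop (2 * l x₀ + 1)] with r hr
  rw [vol, G.measure_eq_encard hm]
  have hr' : 2 * (l x₀ : ℝ) + 1 ≤ r := by exact_mod_cast hr
  have hl0 : (0 : ℝ) ≤ l x₀ := Nat.cast_nonneg _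
  constructor
  · have h1 : {x | l x ≤ r - l x₀} ⊆ G.ball x₀ r := by
      intro x (hx : l x ≤ r - l x₀)
      change G.toSimpleGraph.edist x x₀ ≤ r
      refine (SimpleGraph.edist_triangle (v := o)).trans ?_
      have h2 := edist_root_le hl hb ha0 ha ho x
      have h3 := edist_root_le hl hb ha0 ha ho x₀
      rw [SimpleGraph.edist_comm] at h3
      refine (add_le_add h2 h3).trans ?_
      exact_mod_cast (by omega : l x + l x₀ ≤ r)
    have h4 : ({x | l x ≤ r - l x₀}.encard : ℝ≥0∞) ≤ (G.ball x₀ r).encard := by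
      exact_mod_cast Set.encard_le_encard h1
    refine le_trans ?_ h4
    rw [hV]
    refine ENNReal.ofReal_le_ofReal (le_trans ?_ (le_sum_range_rpow hp hc.le hac _))
    rw [mul_assoc, ← Real.mul_rpow (by norm_num) (by positivity), Nat.cast_sub (by omega)]
    gcongr
    linarith
  · have h1 : G.ball x₀ r ⊆ {x | l x ≤ l x₀ + r} := fun x hx => level_le_of_edist_le hb hx
    have h4 : ((G.ball x₀ r).encard : ℝ≥0∞) ≤ {x | l x ≤ l x₀ + r}.encard := by
      exact_mod_cast Set.encard_le_encard h1
    refine h4.trans ?_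
    rw [hV]
    refine ENNReal.ofReal_le_ofReal ((sum_range_le_rpow hp hC.le haC _).trans ?_)
    rw [mul_assoc, ← Real.mul_rpow (by norm_num) (by positivity)]
    push_cast
    gcongr
    linarith

include hl hb in
-- The tail sums `T` of `w k = V k / (a k * a (k + 1))` give `𝓛 v = 1` exactly: at level `r ≥ 1`, `a
-- (r + 1) * w r - a (r - 1) * w (r - 1) = (V r - V (r - 1)) / a r = 1`.
theorem not_stochasticallyComplete_of_level (hm : G.HasCountingMeasure) (ha0 : a 0 = 1)
    (ha : ∀ r, 0 < a r)
    (hsum : Summable fun k => (∑ j ∈ Finset.range (k + 1), (a j : ℝ)) / (a k * a (k + 1))) :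
    ¬ G.StochasticallyComplete := by
  obtain ⟨o, -⟩ := exists_root hl ha0
  have : Nonempty X := ⟨o⟩
  set V : ℕ → ℝ := fun k => ∑ j ∈ Finset.range (k + 1), (a j : ℝ)
  set w : ℕ → ℝ := fun k => V k / (a k * a (k + 1))
  have hw : ∀ k, 0 ≤ w k := fun k =>
    div_nonneg (Finset.sum_nonneg fun _ _ => Nat.cast_nonneg _) (by positivity)
  set T : ℕ → ℝ := fun r => ∑' k, w (k + r)
  have hT : ∀ r, T r = w r + T (r + 1) := by
    intro r
    have h1 := ((summable_nat_add_iff r).2 hsum).tsum_eq_zero_add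
    simp only [zero_add] at h1
    refine h1.trans ?_
    congr 1
    exact tsum_congr fun k => by rw [add_assoc, add_comm 1 r]
  have hcard := ncard_level hl
  refine G.not_stochasticallyComplete_of_one_le_laplacian (v := fun x => T (l x))
    (fun x => tsum_nonneg fun k => hw _) (fun x => ?_) fun x => le_of_eq ?_
  · refine summable_of_hasFiniteSupport ((finite_sublevel hl (l x + 1)).subset fun y hy => ?_)
    by_contra h
    refine hy ?_
    have h' : ¬ l y ≤ l x + 1 := h
    beta_reduce
    rw [hb, if_neg (by omega), zero_mul]
  · have hpos : ∀ k, (a k : ℝ) ≠ 0 := fun k => by exact_mod_cast (ha k).ne'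
    have h1 : ∀ y, G.b x y * (T (l x) - T (l y))
        = (if l y = l x + 1 then w (l x) else 0)
          - (if l y + 1 = l x then w (l x - 1) else 0) := by
      intro y
      rw [hb]
      rcases lt_trichotomy (l y) (l x) with h | h | h
      · by_cases h2 : l y + 1 = l x
        · rw [if_pos (Or.inr h2.symm), if_neg (by omega), if_pos h2, ← h2, hT (l y)]
          simp
        · rw [if_neg (by omega), if_neg (by omega), if_neg h2]
          simp
      · rw [if_neg (by omega), if_neg (by omega), if_neg (by omega)]
        simp
      · by_cases h2 : l y = l x + 1
        · rw [if_pos (Or.inl h2), if_pos h2, if_neg (by omega), h2, hT (l x)]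
          simp
        · rw [if_neg (by omega), if_neg h2, if_neg (by omega)]
          simp
    have h2 := hasSum_ite_fiber (finite_level hl (l x + 1)) (w (l x))
    rw [laplacian, hm x, tsum_congr h1]
    rcases Nat.eq_zero_or_pos (l x) with h3 | h3
    · rw [hcard] at h2
      simp only [h3, Nat.succ_ne_zero, if_false, sub_zero] at h2 ⊢
      rw [h2.tsum_eq]
      simp only [w, V]
      have := hpos 1
      simp only [zero_add, Finset.range_one, Finset.sum_singleton, ha0, Nat.cast_one]
      field_simp
    · obtain ⟨j, hj⟩ := Nat.exists_eq_add_of_le' h3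
      have h4 := hasSum_ite_fiber (finite_level hl j) (w j)
      rw [hcard] at h2 h4
      simp only [hj, Nat.add_right_cancel_iff, Nat.add_sub_cancel] at h2 ⊢
      rw [(h2.sub h4).tsum_eq]
      have h5 : V (j + 1) = V j + a (j + 1) := Finset.sum_range_succ _ _
      simp only [w, h5]
      have := hpos j
      have := hpos (j + 1)
      have := hpos (j + 1 + 1)
      field_simp
      ring

end Level

theorem IsAntiTree.connected_and_vol_and_not_complete (h : G.IsAntiTree a) {ε : ℝ} (hε : 0 < ε)
    (ho : IsOfOrder (fun r => (a r : ℝ≥0∞)) (2 + ε)) :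
    G.Connected ∧ (∀ x₀ : X, IsOfOrder (G.vol x₀) (3 + ε)) ∧ ¬ G.StochasticallyComplete := by
  obtain ⟨l, hl, hb⟩ := h.exists_level
  have hp : 0 ≤ 2 + ε := by positivity
  obtain ⟨c, C, hc, hC, hcC⟩ := exists_forall_rpow_bounds_of_isOfOrder h.pos hp ho
  refine ⟨connected_of_level hl hb h.zero h.pos, fun x₀ => ?_,
    not_stochasticallyComplete_of_level hl hb h.counting h.zero h.pos ?_⟩
  · have h1 := vol_isOfOrder_of_level hl hb h.counting h.zero h.pos hp hc hC
      (fun r => (hcC r).1) (fun r => (hcC r).2) x₀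
    rwa [show 2 + ε + 1 = 3 + ε by ring] at h1
  -- The numerator has order `k ^ (3 + ε)` and the denominator order `k ^ (4 + 2 ε)`.
  · have h1 : Summable fun k : ℕ => C / c ^ 2 * (1 / ((k + 1 : ℕ) : ℝ) ^ (1 + ε)) :=
      ((summable_nat_add_iff 1).2 (Real.summable_one_div_nat_rpow.2 (by linarith))).mul_left _
    refine h1.of_nonneg_of_le (fun k => by positivity) fun k => ?_
    have h2 := sum_range_le_rpow hp hC.le (fun r => (hcC r).2) k
    have h3 : c * ((k : ℝ) + 1) ^ (2 + ε) ≤ a (k + 1) := by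
      refine le_trans ?_ (hcC (k + 1)).1
      push_cast
      gcongr
      linarith
    have hk : (0 : ℝ) < k + 1 := by positivity
    calc _ ≤ C * ((k : ℝ) + 1) ^ (2 + ε + 1)
          / (c * ((k : ℝ) + 1) ^ (2 + ε) * (c * ((k : ℝ) + 1) ^ (2 + ε))) := by
          gcongr
          exact (hcC k).1
      _ = _ := by
          have h4 : ((k : ℝ) + 1) ^ (2 + ε) = ((k : ℝ) + 1) ^ (1 + ε) * (k + 1) := by
            rw [← Real.rpow_add_one hk.ne']
            ring_nf
          rw [Real.rpow_add_one hk.ne', h4]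
          push_cast
          field_simp

/-- The anti-tree with layers `Fin (a r)`. -/
noncomputable def antiTree (a : ℕ → ℕ) : WeightedGraph (Σ r, Fin (a r)) where
  m _ := 1
  b x y := if y.1 = x.1 + 1 ∨ x.1 = y.1 + 1 then 1 else 0
  m_pos _ := zero_lt_one
  b_nonneg x y := by split_ifs <;> norm_num
  b_self x := if_neg (by omega)
  b_symm x y := by simp only [or_comm]
  b_summable x := by
    refine summable_of_hasFiniteSupport (((Set.finite_le_nat (x.1 + 1)).biUnion
      fun k _ => Set.finite_range (Sigma.mk (β := fun r => Fin (a r)) k)).subset fun y hy => ?_)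
    have h : y.1 ≤ x.1 + 1 := by
      by_contra h
      exact hy (if_neg (by omega))
    exact Set.mem_biUnion (x := y.1) h ⟨y.2, rfl⟩

theorem isAntiTree_antiTree (h0 : a 0 = 1) (ha : ∀ r, 0 < a r) : (antiTree a).IsAntiTree a where
  zero := h0
  pos := ha
  standard x y := by
    change (if _ then (1 : ℝ) else 0) = 0 ∨ (if _ then (1 : ℝ) else 0) = 1
    split_ifs <;> simp
  counting _ := rfl
  layers := by
    refine ⟨fun r => {x | x.1 = r}, fun r s hrs => ?_, ?_, fun r => ?_, fun x y => ?_⟩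
    · exact Set.disjoint_left.2 fun x (hx : x.1 = r) (hy : x.1 = s) => hrs (hx.symm.trans hy)
    · exact Set.eq_univ_of_forall fun x => Set.mem_iUnion.2 ⟨x.1, rfl⟩
    · rw [(antiTree a).measure_eq_encard fun _ => rfl]
      have h1 : {x : Σ r, Fin (a r) | x.1 = r}
          = Sigma.mk r '' (Set.univ : Set (Fin (a r))) := by
        ext ⟨s, i⟩
        constructor
        · rintro rfl
          exact ⟨i, trivial, rfl⟩
        · rintro ⟨j, -, hj⟩
          exact (congrArg Sigma.fst hj).symm
      beta_reduce
      rw [h1, sigma_mk_injective.encard_image, Set.encard_univ, ENat.card_eq_coe_fintype_card,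
        Fintype.card_fin]
      norm_cast
    · change (if y.1 = x.1 + 1 ∨ x.1 = y.1 + 1 then (1 : ℝ) else 0) = 1 ↔
        ∃ r, (x.1 = r ∧ y.1 = r + 1) ∨ (y.1 = r ∧ x.1 = r + 1)
      have h1 : (y.1 = x.1 + 1 ∨ x.1 = y.1 + 1) ↔
          ∃ r, (x.1 = r ∧ y.1 = r + 1) ∨ (y.1 = r ∧ x.1 = r + 1) := by
        constructor
        · rintro (h | h)
          · exact ⟨x.1, Or.inl ⟨rfl, h⟩⟩
          · exact ⟨y.1, Or.inr ⟨rfl, h⟩⟩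
        · rintro ⟨r, h | h⟩ <;> omega
      rw [← h1]
      split_ifs with h <;> simp [h]

end WeightedGraph

/-! ### Existence of the anti-trees and conclusion -/

theorem isOfOrder_floor_rpow_add_one {p : ℝ} (hp : 0 ≤ p) :
    IsOfOrder (fun r : ℕ => ((⌊(r : ℝ) ^ p⌋₊ + 1 : ℕ) : ℝ≥0∞)) p := by
  refine ⟨1, 2, one_pos, two_pos, ?_⟩
  filter_upwards [eventually_ge_atTop 1] with r hr
  have h0 : 0 ≤ (r : ℝ) ^ p := by positivity
  have h1 : 1 ≤ (r : ℝ) ^ p := Real.one_le_rpow (by exact_mod_cast hr) hp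
  have h2 := Nat.floor_le h0
  have h3 := (Nat.lt_floor_add_one ((r : ℝ) ^ p)).le
  rw [← ENNReal.ofReal_natCast]
  push_cast
  exact ⟨ENNReal.ofReal_le_ofReal (by linarith), ENNReal.ofReal_le_ofReal (by linarith)⟩

theorem theoremt :
    -- cubic volume growth implies stochastic completeness
    (∀ (X : Type*) [Countable X] [Infinite X] (G : WeightedGraph X),
      G.HasStandardWeights → G.HasCountingMeasure → G.Connected →
      ∀ x₀ : X,
        (∃ C : ℝ, 0 < C ∧
          ∀ᶠ r : ℕ in atTop, G.vol x₀ r ≤ ENNReal.ofReal (C * (r : ℝ) ^ 3)) →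
        G.StochasticallyComplete) ∧
    -- sharpness: anti-trees with sphere growth of order `r ^ (2 + ε)`
    (∀ ε : ℝ, 0 < ε →
      (∀ (X : Type*) [Countable X] [Infinite X] (G : WeightedGraph X) (a : ℕ → ℕ),
        G.IsAntiTree a → IsOfOrder (fun r => (a r : ℝ≥0∞)) (2 + ε) →
        G.Connected ∧ (∀ x₀ : X, IsOfOrder (G.vol x₀) (3 + ε)) ∧
          ¬ G.StochasticallyComplete) ∧
      (∃ (X : Type) (_ : Countable X) (_ : Infinite X) (G : WeightedGraph X) (a : ℕ → ℕ),
        G.IsAntiTree a ∧ IsOfOrder (fun r => (a r : ℝ≥0∞)) (2 + ε))) := by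
  refine ⟨fun X _ _ G hstd hm hconn x₀ ⟨C, hC, hvol⟩ =>
    G.stochasticallyComplete_of_vol_le hstd hm hconn x₀ hC hvol, fun ε hε =>
    ⟨fun X _ _ G a ha ho => ha.connected_and_vol_and_not_complete hε ho, ?_⟩⟩
  have hp : 0 < 2 + ε := by positivity
  -- The added `1` keeps every layer nonempty and, as `0 ^ (2 + ε) = 0`, makes `a 0 = 1`.
  set a : ℕ → ℕ := fun r => ⌊(r : ℝ) ^ (2 + ε)⌋₊ + 1
  refine ⟨Σ r, Fin (a r), inferInstance,
    Infinite.of_injective (fun r => ⟨r, 0, Nat.succ_pos _⟩) fun r s h => congrArg Sigma.fst h,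
    WeightedGraph.antiTree a, a, WeightedGraph.isAntiTree_antiTree ?_ fun r => Nat.succ_pos _,
    isOfOrder_floor_rpow_add_one hp.le⟩
  simp [a, Real.zero_rpow hp.ne']
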